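/- Let $\mathfrak k=(K,\le_{\mathfrak k})$ be an abstract elementary class in a vocabulary $\tau$, with L\"owenheim--Skolem--Tarski number $\mathrm{LST}$ (the least infinite cardinal $\mu$ such that for all $N\in K$, every $X\subseteq N$ is contained in some $S\le_{\mathfrak k}N$ with $\|S\|\le |X|+\mu$). For $M\in K$ let $\mathfrak k_M$ be the class, in the vocabulary $\tau_M=\tau\cup\{c_a:a\in M\}$ with pairwise distinct new individual constants $c_a$, of all $N$ such that $N\restriction\tau\in K$ and $a\mapsto c_a^N$ is a $\le_{\mathfrak k}$-embedding of $M$ into $N\restriction\tau$; put $N_1\le_{\mathfrak k_M}N_2$ iff $N_1,N_2\in\mathfrak k_M$, $N_1\subseteq N_2$ and $N_1\restriction\tau\le_{\mathfrak k}N_2\restriction\tau$. Models are taken to be nonempty. A template $\Phi$ in a vocabulary $\tau_\Phi$ is a sequence $\langle\Phi(n):n<\omega\rangle$ of complete quantifier-free $n$-types. It is proper for linear orders if for every linear order $I$ there is a $\tau_\Phi$-model $\mathrm{EM}(I,\Phi)$ generated by pairwise distinct elements $a_t$ $(t\in I)$ such that $\langle a_{t_0},\dots,a_{t_{n-1}}\rangle$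 realizes $\Phi(n)$ whenever $t_0<_I\dots<_It_{n-1}$; this model is unique up to isomorphism. For $\mathfrak l=\mathfrak k$ or $\mathfrak l=\mathfrak k_M$, with vocabulary $\tau_{\mathfrak l}$, let $\Upsilon^{\rm or}_\kappa[\mathfrak l]$ be the class of templates $\Phi$ proper for linear orders such that $\tau_{\mathfrak l}\subseteq\tau_\Phi$, $|\tau_\Phi\setminus\tau_{\mathfrak l}|\le\kappa$, and for every linear order $I$: $\|\mathrm{EM}(I,\Phi)\|=|\tau_\Phi|+|I|$, $\mathrm{EM}(I,\Phi)\restriction\tau_{\mathfrak l}\in\mathfrak l$, and $S\restriction\tau_{\mathfrak l}\le_{\mathfrak l}\mathrm{EM}(I,\Phi)\restriction\tau_{\mathfrak l}$ for every submodel $S\subseteq\mathrm{EM}(I,\Phi)$ (in particular for $S=\mathrm{EM}(I_0,\Phi)$ with $I_0\subseteq I$). Such a $\Phi\in\Upsilon^{\rm or}_\kappa[\mathfrak k]$ is standard if $\{c^{\mathrm{EM}(\emptyset,\Phi)}:c\in\tau_\Phi\text{ an individual constant}\}$ is the universe of a submodel of $\mathrm{EM}(\emptyset,\Phi)\restriction\tau$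 which is $\le_{\mathfrak k}\mathrm{EM}(\emptyset,\Phi)\restriction\tau$. Let $\Upsilon^{\rm sor}_\kappa[\mathfrak k_M]$ be the class of $\Phi\in\Upsilon^{\rm or}_\kappa[\mathfrak k_M]$ such that, with $\tau'_\Phi=\tau_\Phi\setminus\{c_a:a\in M\}$: (i) $\Phi$ is a standard member of $\Upsilon^{\rm or}_{\kappa+\|M\|}[\mathfrak k]$; (ii) the individual constants of $\tau_\Phi$ not in $\tau$ are exactly the $c_a$, $a\in M$; (iii) every element of $\mathrm{EM}(\emptyset,\Phi)$ is the value of an individual constant of $\tau_\Phi$; (iv) $|\tau'_\Phi|\le\kappa$; (v) for every linear order $I$ and every submodel $N_1$ of $\mathrm{EM}(I,\Phi)\restriction\tau'_\Phi$, $N_1\restriction\tau\le_{\mathfrak k}\mathrm{EM}(I,\Phi)\restriction\tau$. \textbf{Claim.} Let $M\in K$ have cardinality $\kappa\ge\mathrm{LST}+|\tau|$. The following are equivalent: (a) $\Upsilon^{\rm or}_\kappa[\mathfrak k_M]\ne\emptyset$; (b) for every cardinal $\lambda\ge\kappa$ there is $N\in K$ of cardinality $\lambda$ with $M\le_{\mathfrak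 k}N$; (c) for every ordinal $\alpha<(2^\kappa)^+$ there is $N\in K$ of cardinality $\ge\beth_\alpha$ with $M\le_{\mathfrak k}N$; (d) there is $\Phi\in\Upsilon^{\rm or}_\kappa[\mathfrak k_M]$ such that for every linear order $I$ and $N=\mathrm{EM}(I,\Phi)$, after identifying each $a\in M$ with $c_a^N$, $M$ is the submodel of $N\restriction\tau$ with universe $\{c^N:c\in\tau_\Phi\text{ an individual constant}\}$; (e) $\Upsilon^{\rm sor}_\kappa[\mathfrak k_M]\ne\emptyset$. -/

import Mathlib

open FirstOrder Cardinal

universe u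

noncomputable section

namespace FirstOrder.Language

/-! ### Abstract elementary classes -/

/-- The data `𝔨 = (K, ≤)` of a class of `L`-structures together with a relation `≤` between them.
`Strong f` says that the embedding `f : M → N` is a `≤`-embedding, i.e. that the substructure
`f(M)` of `N` satisfies `f(M) ≤ N`.  In particular, `M ≤ N` for a substructure `M` of `N` is
`Strong` of the inclusion map. -/
structure AbstractClass (L : Language.{u, u}) where
  /-- membership in the class `K` -/
  Mem : ∀ (M : Type u) [L.Structure M], Prop
  /-- being a `≤`-embedding -/
  Strong : ∀ {M N : Type u} [L.Structure M] [L.Structure N], (M ↪[L] N) → Prop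

namespace AbstractClass

variable {L : Language.{u, u}}

/-- `μ` is an infinite cardinal such that every subset `X` of a member `N` of `K` is contained in
some `S ≤ N` of cardinality at most `|X| + μ`. -/
def IsLSTBound (k : AbstractClass L) (μ : Cardinal.{u}) : Prop :=
  ℵ₀ ≤ μ ∧ ∀ (N : Type u) [L.Structure N], k.Mem N → ∀ X : Set N,
    ∃ S : L.Substructure N, X ⊆ S ∧ k.Strong S.subtype ∧ #S ≤ #X + μ

/-- The Löwenheim-Skolem-Tarski number `LST`. -/
def lst (k : AbstractClass L) : Cardinal.{u} := sInf {μ | k.IsLSTBound μ}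

/-- The axioms of an abstract elementary class. -/
structure IsAEC (k : AbstractClass L) : Prop where
  /-- `K` is closed under isomorphism -/
  mem_of_equiv : ∀ {M N : Type u} [L.Structure M] [L.Structure N],
    (M ≃[L] N) → k.Mem M → k.Mem N
  /-- `≤` is a relation on `K` -/
  mem_of_strong : ∀ {M N : Type u} [L.Structure M] [L.Structure N] (f : M ↪[L] N),
    k.Strong f → k.Mem M ∧ k.Mem N
  /-- `≤` is reflexive on `K` (and, with `strong_comp`, respects isomorphisms) -/
  strong_of_equiv : ∀ {M N : Type u} [L.Structure M] [L.Structure N] (e : M ≃[L] N),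
    k.Mem M → k.Strong e.toEmbedding
  /-- `≤` is transitive -/
  strong_comp : ∀ {M N P : Type u} [L.Structure M] [L.Structure N] [L.Structure P]
    (f : M ↪[L] N) (g : N ↪[L] P), k.Strong f → k.Strong g → k.Strong (g.comp f)
  /-- coherence: if `M₁ ⊆ M₂`, `M₁ ≤ M₃` and `M₂ ≤ M₃`, then `M₁ ≤ M₂` -/
  coherence : ∀ {M N P : Type u} [L.Structure M] [L.Structure N] [L.Structure P]
    (f : M ↪[L] N) (g : N ↪[L] P), k.Strong (g.comp f) → k.Strong g → k.Strong f
  /-- the union `A` of a `≤`-increasing continuous chain `S i` of limit length is in `K`, is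
  `≥` all members of the chain, and is `≤ N` whenever all members of the chain are `≤ N` -/
  chain : ∀ {A : Type u} [L.Structure A] {ι : Type u} [LinearOrder ι] [WellFoundedLT ι]
    [Nonempty ι] [NoMaxOrder ι] (S : ι → L.Substructure A) (hS : Monotone S),
    (∀ i j (h : i ≤ j), k.Strong (Substructure.inclusion (hS h))) →
    (∀ i, Order.IsSuccLimit i → ∀ x ∈ S i, ∃ j < i, x ∈ S j) →
    (∀ x : A, ∃ i, x ∈ S i) →
    k.Mem A ∧ (∀ i, k.Strong (S i).subtype) ∧
      ∀ {N : Type u} [L.Structure N] (f : A ↪[L] N),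
        (∀ i, k.Strong (f.comp (S i).subtype)) → k.Strong f
  /-- the Löwenheim-Skolem-Tarski axiom -/
  exists_isLSTBound : ∃ μ, k.IsLSTBound μ

end AbstractClass

/-! ### Reducts and symbols -/

section Reduct

variable {L L' : Language.{u, u}}

/-- An embedding of `L'`-structures is an embedding of their reducts. -/
def Embedding.reductAlong (φ : L →ᴸ L') {M N : Type u} [L'.Structure M] [L'.Structure N]
    (g : M ↪[L'] N) :
    letI := φ.reduct M; letI := φ.reduct N; M ↪[L] N :=
  letI := φ.reduct M
  letI := φ.reduct N
  { toEmbedding := g.toEmbedding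
    map_fun' := fun f x => g.map_fun' (φ.onFunction f) x
    map_rel' := fun r x => g.map_rel' (φ.onRelation r) x }

/-- The reduct of the `L'`-structure `A` along `φ` is in `K`. -/
def AbstractClass.MemReduct (k : AbstractClass L) (φ : L →ᴸ L') (A : Type u) [L'.Structure A] :
    Prop :=
  letI := φ.reduct A
  k.Mem A

/-- The set `X ⊆ A` is (the universe of) a substructure `S` of the reduct of the `L'`-structure
`A` along `φ`, and `S ≤ A` in the sense of `k`. -/
def AbstractClass.StrongReduct (k : AbstractClass L) (φ : L →ᴸ L') {A : Type u} [L'.Structure A]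
    (X : Set A) : Prop :=
  letI := φ.reduct A
  ∃ S : L.Substructure A, (S : Set A) = X ∧ k.Strong S.subtype

/-- The map on symbols given by a map of vocabularies. -/
def LHom.onSymbols (φ : L →ᴸ L') : L.Symbols → L'.Symbols :=
  Sum.map (Sigma.map id fun _ f => φ.onFunction f) (Sigma.map id fun _ r => φ.onRelation r)

end Reduct

/-! ### Templates and Ehrenfeucht-Mostowski models -/

/-- The complete quantifier-free type of a finite tuple. -/
def qfType (L : Language.{u, u}) {A : Type u} [L.Structure A] {n : ℕ} (x : Fin n → A) :
    Set (L.Formula (Fin n)) :=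
  {ψ | ψ.IsQF ∧ ψ.Realize x}

/-- An `ω`-sequence whose `n`-th element is a set of `n`-formulas of the vocabulary `L`. -/
abbrev Template (L : Language.{u, u}) : Type u := ∀ n : ℕ, Set (L.Formula (Fin n))

namespace Template

variable {L' : Language.{u, u}}

/-- `A` is `EM(I, Φ)` with skeleton `⟨a t : t ∈ I⟩`: the `a t` are distinct, they generate `A`,
and every increasing `n`-tuple of them has quantifier-free type `Φ n`. -/
structure IsEM (Φ : Template L') (I : Type u) [LinearOrder I] (A : Type u) [L'.Structure A]
    (a : I → A) : Prop where
  injective : Function.Injective a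
  generates : Substructure.closure L' (Set.range a) = ⊤
  qfType_eq : ∀ (n : ℕ) (t : Fin n → I), StrictMono t → qfType L' (fun i => a (t i)) = Φ n

/-- `Φ` is proper for linear orders: `EM(I, Φ)` exists for every linear order `I`. (Taking
`I = {0 < ⋯ < n - 1}` shows that `Φ n` is then a complete quantifier-free `n`-type.) -/
def Proper (Φ : Template L') : Prop :=
  ∀ (I : Type u) [LinearOrder I], ∃ (A : Type u) (_ : L'.Structure A) (a : I → A), Φ.IsEM I A a

variable {L : Language.{u, u}}

/-- `Φ ∈ Υᵒʳ_κ[𝔨]`, where the injection `φ` exhibits the vocabulary of `𝔨` as a subset of the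
vocabulary `L'` of `Φ`. As the model `EM(I, Φ)` is determined only up to isomorphism, statements
about it are made for all of its copies `A`. -/
structure IsOr (k : AbstractClass L) (κ : Cardinal.{u}) (φ : L →ᴸ L') (Φ : Template L') :
    Prop where
  proper : Φ.Proper
  injective : φ.Injective
  /-- at most `κ` symbols are added to the vocabulary of `𝔨` -/
  card_new_symbols : #((Set.range φ.onSymbols)ᶜ : Set L'.Symbols) ≤ κ
  card_em : ∀ (I : Type u) [LinearOrder I] (A : Type u) [L'.Structure A] (a : I → A),
    Φ.IsEM I A a → #A = L'.card + #I
  mem_em : ∀ (I : Type u) [LinearOrder I] (A : Type u) [L'.Structure A] (a : I → A),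
    Φ.IsEM I A a → k.MemReduct φ A
  /-- for every linear order `J`, every submodel `S` of `EM(J, Φ)` satisfies `S ≤ EM(J, Φ)` after
  reduction to the vocabulary of `𝔨`; this covers `S = EM(I, Φ)` for `I ⊆ J`. Models are nonempty. -/
  strong_em : ∀ (J : Type u) [LinearOrder J] (A : Type u) [L'.Structure A] (a : J → A),
    Φ.IsEM J A a → ∀ S : L'.Substructure A, (S : Set A).Nonempty →
      k.StrongReduct φ (S : Set A)

/-- The set of values of the individual constants of the vocabulary `L'` in `A`. -/
def constantValues (L' : Language.{u, u}) (A : Type u) [L'.Structure A] : Set A :=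
  Set.range fun c : L'.Constants => (c : A)

/-- `Φ ∈ Υˢᵒʳ_κ[𝔨]`: `Φ ∈ Υᵒʳ_κ[𝔨]` is standard, i.e. the individual constants form a
submodel `N ≤ EM(∅, Φ)` in the sense of `𝔨`. -/
structure IsSor (k : AbstractClass L) (κ : Cardinal.{u}) (φ : L →ᴸ L') (Φ : Template L') : Prop
    extends IsOr k κ φ Φ where
  standard : ∀ (I : Type u) [LinearOrder I] [IsEmpty I] (A : Type u) [L'.Structure A] (a : I → A),
    Φ.IsEM I A a → k.StrongReduct φ (constantValues L' A)

end Template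

/-! ### The class `𝔨_M` of `≤`-extensions of `M` -/

/-- The class `𝔨_M`, in the vocabulary `L[[M]]` of `𝔨` with a new constant `c_a` for each
`a ∈ M`: its members are the `N` whose reduct to `L` is in `K` and for which `a ↦ c_a` is a
`≤`-embedding of `M` into `N`; its relation `≤` is that of `𝔨` on reducts. -/
def AbstractClass.over {L : Language.{u, u}} (k : AbstractClass L) (M : Type u) [L.Structure M] :
    AbstractClass L[[M]] :=
  let InClass : ∀ (N : Type u) [L[[M]].Structure N], Prop := fun N _ =>
    letI := (L.lhomWithConstants M).reduct N
    k.Mem N ∧ ∃ f : M ↪[L] N, (∀ a, f a = ((L.con a : L[[M]].Constants) : N)) ∧ k.Strong f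
  { Mem := InClass
    Strong := fun {N₁ N₂} _ _ g =>
      InClass N₁ ∧ InClass N₂ ∧
        letI := (L.lhomWithConstants M).reduct N₁
        letI := (L.lhomWithConstants M).reduct N₂
        k.Strong (g.reductAlong (L.lhomWithConstants M)) }

namespace Template

variable {L L' : Language.{u, u}}

/-- The symbols `c_a`, `a ∈ M`, in a vocabulary `L'` extending (via `ψ`) the one of `𝔨_M`. -/
def nameOf {M : Type u} (ψ : L[[M]] →ᴸ L') (a : M) : L'.Constants := ψ.onFunction (L.con a)

/-- `X` is closed under all function symbols of `L'` other than the constants `c_a`. -/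
def ClosedUnderUnnamed {M : Type u} (ψ : L[[M]] →ᴸ L') {A : Type u} [L'.Structure A]
    (X : Set A) : Prop :=
  ∀ (n : ℕ) (f : L'.Functions n),
    (∀ a : M, (⟨n, f⟩ : Σ l, L'.Functions l) ≠ ⟨0, nameOf ψ a⟩) → ClosedUnder f X

/-- `Φ ∈ Υˢᵒʳ_κ[𝔨_M]`, i.e. `Φ ∈ Υᵒʳ_κ[𝔨_M]` is `κ`-standard. Here `ψ` exhibits the vocabulary
`L[[M]]` of `𝔨_M` as a subset of the vocabulary `L'` of `Φ`; below, `τ'` is `L'` without the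
constants `c_a`. -/
structure IsSorOver (k : AbstractClass L) (M : Type u) [L.Structure M] (κ : Cardinal.{u})
    (ψ : L[[M]] →ᴸ L') (Φ : Template L') : Prop where
  isOr : IsOr (k.over M) κ ψ Φ
  isSor : IsSor k (κ + #M) (ψ.comp (L.lhomWithConstants M)) Φ
  /-- the `c_a` are all the individual constants of `L'` which are not in the vocabulary of `𝔨` -/
  constants_eq : Set.range (nameOf ψ) =
    (Set.range fun c : L.Constants => (ψ.comp (L.lhomWithConstants M)).onFunction c)ᶜ
  /-- `Φ` is fully standard -/
  fully : ∀ (I : Type u) [LinearOrder I] [IsEmpty I] (A : Type u) [L'.Structure A] (a : I → A),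
    Φ.IsEM I A a → constantValues L' A = Set.univ
  /-- `|τ'| ≤ κ` -/
  card_unnamed :
    #((Set.range fun a => (Sum.inl ⟨0, nameOf ψ a⟩ : L'.Symbols))ᶜ : Set L'.Symbols) ≤ κ
  /-- every submodel `S` of the `τ'`-reduct of `EM(I, Φ)` satisfies `S ≤ EM(I, Φ)` after
  reduction to the vocabulary of `𝔨` -/
  strong_unnamed : ∀ (I : Type u) [LinearOrder I] (A : Type u) [L'.Structure A] (a : I → A),
    Φ.IsEM I A a → ∀ X : Set A, X.Nonempty → ClosedUnderUnnamed ψ X →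
      k.StrongReduct (ψ.comp (L.lhomWithConstants M)) X

end Template

end FirstOrder.Language

end

/-! The substance lies in passing from (c) to (e); the other implications follow from the
definitions and from the cardinalities of Ehrenfeucht–Mostowski models.

Given M ≤ N, choose for every finite s ⊆ N a strong submodel G(s) of size at most κ containing s and
M, increasing in s and equal to M when s ⊆ M. As |M| = κ, function symbols indexed by M, in each
positive arity, can list G({x₁, …, xₙ}) as values at (x₁, …, xₙ). A nonempty set closed under these
functions is a directed union of sets G(s), hence strong, once the chain axioms are extended to
directed unions (`strong_finset_union`). Moreover M itself is closed. These are the properties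
collected in `ClosedStrong` and obtained in `exists_closedStrong`.

The expanded vocabulary has at most κ symbols, so there are at most 2^κ quantifier-free n-types.
Morley's method (Erdős–Rado for each n in turn, with the regularity of (2^κ)⁺) gives a template
realized by arbitrarily long finite sequences in such expansions (`exists_finitelyRealized`). An
ultraproduct then shows that it is proper.

`ClosedStrong` is not a first-order property, so Łoś's theorem does not transfer it to EM(I, Φ). It
does pass to substructures and to directed unions, and every finite part of the skeleton generates a
structure embeddable in one of the original expansions; hence EM(I, Φ) has it too
(`ClosedStrong.of_isEM`). Since M stays closed under all functions, all constants take values in M,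
and the template is κ-standard. -/

/-! ### The Erdős–Rado theorem -/

namespace ErdosRado

open Classical in
/-- A sequence, indexed by a well-order `I`, of elements of `W` whose `f`-colours over the earlier
elements of the sequence agree with those of `w`. -/
noncomputable def seq {W C I : Type u} [LinearOrder I] [WellFoundedLT I] [Nonempty W]
    (f : Finset W → C) (w : W) : I → W :=
  WellFoundedLT.fix fun i y => Classical.epsilon fun v => (∀ j : Set.Iio i, v ≠ y j.1 j.2) ∧
    ∀ s : Finset (Set.Iio i), f (insert v (s.image fun j => y j.1 j.2)) =
      f (insert w (s.image fun j => y j.1 j.2))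

section

variable {W C I : Type u} [LinearOrder I] [WellFoundedLT I] [Nonempty W] (f : Finset W → C)

open Classical in
theorem seq_eq (w : W) (i : I) :
    seq f w i = Classical.epsilon fun v => (∀ j : Set.Iio i, v ≠ seq f w j.1) ∧
      ∀ s : Finset (Set.Iio i), f (insert v (s.image fun j => seq f w j.1)) =
        f (insert w (s.image fun j => seq f w j.1)) := by
  rw [seq, WellFoundedLT.fix_eq]

-- As long as `w` has not yet been listed, `w` itself satisfies the condition from which the next
-- term is chosen.
open Classical in
theorem seq_spec (w : W) (i : I) (h : ∀ j < i, w ≠ seq f w j) :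
    (∀ j < i, seq f w i ≠ seq f w j) ∧
    ∀ s : Finset I, (∀ j ∈ s, j < i) → f (insert (seq f w i) (s.image (seq f w))) =
      f (insert w (s.image (seq f w))) := by
  have key : (∀ j : Set.Iio i, seq f w i ≠ seq f w j.1) ∧
      ∀ s : Finset (Set.Iio i), f (insert (seq f w i) (s.image fun j => seq f w j.1)) =
        f (insert w (s.image fun j => seq f w j.1)) := by
    rw [seq_eq f w i]
    exact Classical.epsilon_spec (p := fun v => (∀ j : Set.Iio i, v ≠ seq f w j.1) ∧
      ∀ s : Finset (Set.Iio i), f (insert v (s.image fun j => seq f w j.1)) =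
        f (insert w (s.image fun j => seq f w j.1))) ⟨w, fun j => h j.1 j.2, fun s => rfl⟩
  refine ⟨fun j hj => key.1 ⟨j, hj⟩, fun s hs => ?_⟩
  have := key.2 (s.subtype (· ∈ Set.Iio i))
  have e : (s.subtype (· ∈ Set.Iio i)).image (fun j => seq f w j.1) = s.image (seq f w) := by
    ext x
    simp only [Finset.mem_image, Finset.mem_subtype, Subtype.exists]
    constructor
    · rintro ⟨a, _, h1, h2⟩
      exact ⟨a, h1, h2⟩
    · rintro ⟨a, h1, h2⟩
      exact ⟨a, hs a h1, h1, h2⟩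
  rwa [e] at this

-- The sequence followed by `w` sees `w` only through its colours over earlier terms, so equal
-- colours produce the same choices. This makes the coding of points by colours injective.
open Classical in
theorem seq_congr (w w' : W) (i : I)
    (h : ∀ s : Finset (Set.Iio i), f (insert w (s.image fun j => seq f w j.1)) =
      f (insert w' (s.image fun j => seq f w' j.1))) :
    ∀ k ≤ i, seq f w k = seq f w' k := by
  intro k
  induction k using WellFoundedLT.induction with
  | ind k ih =>
    intro hk
    have e : (fun j : Set.Iio k => seq f w j.1) = fun j : Set.Iio k => seq f w' j.1 :=
      funext fun j => ih j.1 j.2 (j.2.le.trans hk)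
    rw [seq_eq f w k, seq_eq f w' k]
    congr 1
    funext v
    have e2 : ∀ s : Finset (Set.Iio k), f (insert w (s.image fun j => seq f w j.1)) =
        f (insert w' (s.image fun j => seq f w' j.1)) := by
      intro s
      have := h (s.image fun j => ⟨j.1, lt_of_lt_of_le j.2 hk⟩)
      simpa only [Finset.image_image, Function.comp_def] using this
    rw [← e]
    simp only [e2]
    simp only [← e, funext_iff.1 e]

end

variable {W C : Type u}

/-- If `W` is large enough, there is a long sequence which is end-homogeneous for `f`. -/
theorem exists_end_homogeneous {μ : Cardinal.{u}} (hμ : ℵ₀ ≤ μ) (hC : #C ≤ μ)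
    (hW : 2 ^ μ < #W) (f : Finset W → C) :
    ∃ (I : Type u) (_ : LinearOrder I) (y : I → W) (g : Finset I → C), μ < #I ∧
      Function.Injective y ∧ ∀ (s : Finset I) (i : I), (∀ j ∈ s, j < i) →
        ∀ t : Finset W, (∀ x, x ∈ t ↔ x = y i ∨ ∃ j ∈ s, y j = x) → f t = g s := by
  classical
  have : Nonempty W := by
    rw [← mk_ne_zero_iff]
    exact (lt_of_le_of_lt (zero_le) hW).ne'
  let I := (Order.succ μ).ord.ToType
  have hI : #I = Order.succ μ := by simp [I]
  have hIio : ∀ i : I, #(Set.Iio i) ≤ μ := fun i => by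
    have := mk_Iio_lt i (by simp [I])
    rwa [hI, Order.lt_succ_iff] at this
  by_cases hit : ∃ w : W, ∀ i : I, w ≠ seq f w i
  · obtain ⟨w, hw⟩ := hit
    refine ⟨I, inferInstance, seq f w, fun s => f (insert w (s.image (seq f w))), ?_, ?_, ?_⟩
    · rw [hI]; exact Order.lt_succ μ
    · intro i j hij
      by_contra hne
      rcases lt_or_gt_of_ne hne with h | h
      · exact (seq_spec f w j fun k _ => hw k).1 i h hij.symm
      · exact (seq_spec f w i fun k _ => hw k).1 j h hij
    · intro s i hs t ht
      have : t = insert (seq f w i) (s.image (seq f w)) := by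
        ext x; simp [ht]
      rw [this]
      exact (seq_spec f w i fun k _ => hw k).2 s hs
  · exfalso
    push Not at hit
    choose i hi using hit
    -- If every `w` occurs in its own sequence, then `w` is determined by its position and its
    -- colours over the earlier terms. This allows at most μ⁺ · 2^μ = 2^μ points.
    let code : W → Σ i : I, (Finset (Set.Iio i) → C) := fun w =>
      ⟨i w, fun s => f (insert w (s.image fun j => seq f w j.1))⟩
    have hinj : Function.Injective code := by
      intro w w' h
      have h1 : i w = i w' := congrArg Sigma.fst h
      have h2 : ∀ s : Finset (Set.Iio (i w)), f (insert w (s.image fun j => seq f w j.1)) =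
          f (insert w' (s.image fun j => seq f w' j.1)) := by
        simp only [code, Sigma.mk.injEq] at h
        obtain ⟨h1, h2⟩ := h
        intro s
        have : ∀ (a b : I) (e : a = b) (F : Finset (Set.Iio a) → C) (G : Finset (Set.Iio b) → C),
            F ≍ G → ∀ s : Finset (Set.Iio a), F s = G (s.image fun j => ⟨j.1, e ▸ j.2⟩) := by
          rintro a b rfl F G h s
          rw [eq_of_heq h]; simp
        rw [this _ _ h1 _ _ h2 s]
        simp [Finset.image_image, Function.comp_def]
      have := seq_congr f w w' (i w) h2 (i w) le_rfl
      rw [hi w, this, h1, ← hi w']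
    have h1 : #W ≤ #(Σ i : I, (Finset (Set.Iio i) → C)) := mk_le_of_injective hinj
    have h2 : #(Σ i : I, (Finset (Set.Iio i) → C)) ≤ 2 ^ μ := by
      rw [mk_sigma]
      refine (sum_le_sum _ (fun _ => 2 ^ μ) fun i => ?_).trans ?_
      · rw [← power_def]
        have hF : #(Finset (Set.Iio i)) ≤ μ := by
          rcases finite_or_infinite (Set.Iio i) with hfin | hinf
          · exact (mk_le_aleph0).trans hμ
          · rw [mk_finset_of_infinite]; exact hIio i
        calc #C ^ #(Finset (Set.Iio i)) ≤ (2 ^ μ) ^ #(Finset (Set.Iio i)) :=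
              power_le_power_right (hC.trans (cantor μ).le)
          _ ≤ (2 ^ μ) ^ μ := power_le_power_left
              (ne_of_gt (lt_of_lt_of_le aleph0_pos (hμ.trans (cantor μ).le))) hF
          _ = 2 ^ μ := by rw [← power_mul, mul_eq_self hμ]
      · rw [sum_const', hI]
        exact (mul_le_mul' (Order.succ_le_of_lt (cantor μ)) le_rfl).trans
          (mul_eq_self (hμ.trans (cantor μ).le)).le
    exact absurd (h1.trans h2) (not_le.2 hW)

/-- The Erdős–Rado theorem, for the towers of exponentials given by the `ℶ` function. -/
theorem exists_homogeneous (α : Ordinal.{u}) (hC : #C ≤ ℶ_ α) (n : ℕ) :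
    ∀ (W : Type u) (f : Finset W → C), ℶ_ (α + n) < #W →
      ∃ Z : Set W, ℶ_ α < #Z ∧ ∃ c : C, ∀ s : Finset W, ↑s ⊆ Z → s.card = n → f s = c := by
  classical
  induction n with
  | zero =>
    intro W f hW
    refine ⟨Set.univ, by simpa using hW, f ∅, fun s _ h => ?_⟩
    rw [Finset.card_eq_zero.1 h]
  | succ n ih =>
    intro W f hW
    have hW' : 2 ^ ℶ_ (α + n) < #W := by
      rwa [Nat.cast_add, Nat.cast_one, ← add_assoc, beth_add_one] at hW
    obtain ⟨I, _, y, g, hI, hy, hg⟩ := exists_end_homogeneous (aleph0_le_beth _)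
      (hC.trans (beth_mono le_self_add)) hW' f
    obtain ⟨Z, hZ, c, hc⟩ := ih I g hI
    refine ⟨y '' Z, by rwa [mk_image_eq hy], c, fun s hs hcard => ?_⟩
    obtain ⟨s', hs', rfl⟩ := Finset.subset_set_image_iff.1 hs
    rw [Finset.card_image_of_injective _ hy] at hcard
    have hne : s'.Nonempty := Finset.card_pos.1 (by omega)
    -- End-homogeneity: the colour depends only on what remains after removing the maximum, which
    -- lowers the exponent by one.
    rw [hg (s'.erase (s'.max' hne)) (s'.max' hne)
      fun j hj => Finset.lt_max'_of_mem_erase_max' _ _ hj]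
    · refine hc _ (fun x hx => hs' (Finset.erase_subset _ _ hx)) ?_
      rw [Finset.card_erase_of_mem (Finset.max'_mem _ _)]; omega
    · intro x
      simp only [Finset.mem_image, Finset.mem_erase]
      constructor
      · rintro ⟨a, ha, rfl⟩
        by_cases h : a = s'.max' hne
        · exact Or.inl (by rw [← h])
        · exact Or.inr ⟨a, ⟨h, ha⟩, rfl⟩
      · rintro (rfl | ⟨a, ⟨_, ha⟩, rfl⟩)
        · exact ⟨_, Finset.max'_mem _ _, rfl⟩
        · exact ⟨a, ha, rfl⟩

end ErdosRado

namespace FirstOrder.Language.AbstractClass.IsAEC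

/-! ### Unions of directed systems in an abstract elementary class -/

variable {L : Language.{u, u}} {k : AbstractClass L} (hk : k.IsAEC)

include hk

/-- An embedding is an isomorphism onto its image followed by the inclusion, so strength depends on
the image alone. -/
theorem strong_of_range_eq {M M' N : Type u} [L.Structure M] [L.Structure M'] [L.Structure N]
    {f : M ↪[L] N} (hf : k.Strong f) (g : M' ↪[L] N) (h : Set.range f = Set.range g) :
    k.Strong g := by
  have h1 : k.Strong f.toHom.range.subtype := by
    have h2 := hk.strong_comp f.equivRange.symm.toEmbedding f
      (hk.strong_of_equiv _ (hk.mem_of_equiv f.equivRange (hk.mem_of_strong f hf).1)) hf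
    convert h2 using 1
    ext x
    obtain ⟨y, rfl⟩ := f.equivRange.surjective x
    simp
  have h3 : f.toHom.range = g.toHom.range := SetLike.coe_injective (by
    rw [Hom.range_coe, Hom.range_coe]
    exact h)
  rw [h3] at h1
  have h4 := hk.strong_comp g.equivRange.toEmbedding g.toHom.range.subtype
    (hk.strong_of_equiv _ (hk.mem_of_equiv g.equivRange.symm (hk.mem_of_strong _ h1).1)) h1
  rwa [Embedding.subtype_equivRange] at h4

/-- The simultaneous induction behind `strong_finset_union` and `mem_finset_union`. -/
theorem finset_union {A : Type u} [L.Structure A] (c : Cardinal.{u}) :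
    ∀ (I : Type u), #I = c → ∀ (S : Finset I → L.Substructure A) (hS : Monotone S),
    (∀ s t (h : s ≤ t), k.Strong (Substructure.inclusion (hS h))) →
    ∀ T : L.Substructure A, (∀ x, x ∈ T ↔ ∃ s, x ∈ S s) →
    k.Mem T ∧ (∀ s (h : S s ≤ T), k.Strong (Substructure.inclusion h)) ∧
      ∀ {N : Type u} [L.Structure N] (f : T ↪[L] N),
        (∀ s (h : S s ≤ T), k.Strong (f.comp (Substructure.inclusion h))) → k.Strong f := by
  induction c using WellFoundedLT.induction with
  | ind c ih =>
  intro I hI S hS hstr T hT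
  have hle : ∀ s, S s ≤ T := fun s x hx => (hT x).2 ⟨s, hx⟩
  rcases finite_or_infinite I with hfin | hinf
  · cases nonempty_fintype I
    have htop : T = S Finset.univ := le_antisymm
      (fun x hx => by
        obtain ⟨s, hs⟩ := (hT x).1 hx
        exact hS (Finset.subset_univ s) hs) (hle _)
    subst htop
    have hmem := (hk.mem_of_strong _ (hstr Finset.univ Finset.univ le_rfl)).1
    exact ⟨hmem, fun s h => hstr s _ (Finset.subset_univ s), fun f hf => hf Finset.univ le_rfl⟩
  -- Ordering `I` in the type of its initial ordinal makes all proper initial segments smaller, so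
  -- the induction hypothesis applies to the union `R j` over finite subsets of the segment below
  -- `j`. The `R j` form a chain with union `T`.
  · let J := (#I).ord.ToType
    have hJ : #J = #I := by simp [J]
    obtain ⟨e⟩ := Cardinal.eq.1 hJ.symm
    have : NoMaxOrder J := Cardinal.noMaxOrder (aleph0_le_mk I)
    have : Nonempty J := e.nonempty_congr.1 inferInstance
    classical
    let emb : ∀ j : J, Set.Iio j ↪ I := fun j =>
      (Function.Embedding.subtype _).trans e.symm.toEmbedding
    have hemb : ∀ (j : J) (s : Finset I), (∀ x ∈ s, e x < j) →
        ∃ s' : Finset (Set.Iio j), s'.map (emb j) = s := fun j s hs => by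
      refine ⟨s.attach.image fun x => ⟨e x.1, hs x.1 x.2⟩, ?_⟩
      ext x
      constructor
      · intro hx
        obtain ⟨_, hy, rfl⟩ := Finset.mem_map.1 hx
        obtain ⟨z, -, rfl⟩ := Finset.mem_image.1 hy
        exact (e.symm_apply_apply z.1).symm ▸ z.2
      · intro hx
        exact Finset.mem_map.2 ⟨⟨e x, hs x hx⟩,
          Finset.mem_image.2 ⟨⟨x, hx⟩, Finset.mem_attach _ _, rfl⟩, e.symm_apply_apply x⟩
    have hemb' : ∀ (j : J) (s' : Finset (Set.Iio j)), ∀ x ∈ s'.map (emb j), e x < j := by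
      intro j s' x hx
      obtain ⟨y, -, rfl⟩ := Finset.mem_map.1 hx
      exact (e.apply_symm_apply y.1).symm ▸ y.2
    let S' : ∀ j : J, Finset (Set.Iio j) → L.Substructure A := fun j s => S (s.map (emb j))
    have hS' : ∀ j, Monotone (S' j) := fun j s t h => hS (Finset.map_subset_map.2 h)
    let R : J → L.Substructure A := fun j => ⨆ s, S' j s
    have hR' : ∀ j x, x ∈ R j ↔ ∃ s, x ∈ S' j s := fun j x =>
      Substructure.mem_iSup_of_directed (hS' j).directed_le
    have hR : ∀ j x, x ∈ R j ↔ ∃ s, (∀ y ∈ s, e y < j) ∧ x ∈ S s := by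
      intro j x
      rw [hR']
      constructor
      · rintro ⟨s, hs⟩
        exact ⟨_, hemb' j s, hs⟩
      · rintro ⟨s, hs, hx⟩
        obtain ⟨s', rfl⟩ := hemb j s hs
        exact ⟨s', hx⟩
    have IH := fun j => ih #(Set.Iio j) ((mk_Iio_lt j (by simp [J])).trans_eq (hJ.trans hI))
      (Set.Iio j) rfl (S' j) (hS' j) (fun s t h => hstr _ _ (Finset.map_subset_map.2 h)) (R j) (hR' j)
    have hRT : ∀ j, R j ≤ T := fun j x hx => by
      obtain ⟨s, -, hs⟩ := (hR j x).1 hx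
      exact hle s hs
    have hRmono : Monotone R := fun i j hij x hx => by
      obtain ⟨s, h, hs⟩ := (hR i x).1 hx
      exact (hR j x).2 ⟨s, fun y hy => (h y hy).trans_le hij, hs⟩
    have hSR : ∀ j s (_ : ∀ y ∈ s, e y < j), S s ≤ R j := fun j s h x hx => (hR j x).2 ⟨s, h, hx⟩
    have hSRs : ∀ j s (h : ∀ y ∈ s, e y < j), k.Strong (Substructure.inclusion (hSR j s h)) := by
      intro j s h
      obtain ⟨s', rfl⟩ := hemb j s h
      exact (IH j).2.1 s' _
    have hRR : ∀ i j (h : i ≤ j), k.Strong (Substructure.inclusion (hRmono h)) := by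
      intro i j h
      refine (IH i).2.2 _ fun s hs => ?_
      exact hSRs j _ fun y hy => (hemb' i s y hy).trans_le h
    -- The chain axiom concerns substructures of `T`, so each `R j` is replaced by its copy inside
    -- `T`.
    have hchain := hk.chain (A := T) (ι := J)
      (fun j => (Substructure.inclusion (hRT j)).toHom.range)
      (by
        rintro i j h _ ⟨x, rfl⟩
        exact ⟨⟨x.1, hRmono h x.2⟩, rfl⟩)
      (by
        intro i j h
        refine hk.coherence _ (Substructure.inclusion (hRT j)).equivRange.symm.toEmbedding ?_
          (hk.strong_of_equiv _ (hk.mem_of_equiv (Substructure.inclusion (hRT j)).equivRange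
            (IH j).1))
        refine hk.strong_of_range_eq (hRR i j h) _ ?_
        have key : ∀ x : R i, (Substructure.inclusion (hRT j)).equivRange.symm
            ⟨⟨x.1, hRT i x.2⟩, ⟨⟨x.1, hRmono h x.2⟩, rfl⟩⟩ = Substructure.inclusion (hRmono h) x := by
          intro x
          exact (Substructure.inclusion (hRT j)).equivRange.symm_apply_apply
            (Substructure.inclusion (hRmono h) x)
        ext y
        constructor
        · rintro ⟨x, rfl⟩
          exact ⟨⟨⟨x.1, hRT i x.2⟩, ⟨x, rfl⟩⟩, key x⟩
        · rintro ⟨⟨_, ⟨x, rfl⟩⟩, rfl⟩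
          exact ⟨x, (key x).symm⟩)
      (by
        rintro i hi _ ⟨x, rfl⟩
        obtain ⟨s, hs, hx⟩ := (hR i _).1 x.2
        -- Continuity of the chain: a finite set below a limit is already below some smaller index.
        obtain ⟨j, hj, hjs⟩ : ∃ j < i, ∀ y ∈ s, e y < j := by
          rcases s.eq_empty_or_nonempty with rfl | hne
          · obtain ⟨j, hj⟩ := not_isMin_iff.1 hi.not_isMin
            exact ⟨j, hj, by simp⟩
          · obtain ⟨j, h1, h2⟩ := (hi.lt_iff_exists_lt).1
              ((Finset.sup'_lt_iff hne (f := e)).2 hs)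
            exact ⟨j, h1, (Finset.sup'_lt_iff hne).1 h2⟩
        exact ⟨j, hj, ⟨⟨x.1, hSR j s hjs hx⟩, rfl⟩⟩)
      (by
        intro x
        obtain ⟨s, hs⟩ := (hT _).1 x.2
        obtain ⟨m, hm⟩ := (s.image e).exists_le
        obtain ⟨j, hj⟩ := exists_gt m
        refine ⟨j, ⟨⟨x.1, hSR j s (fun y hy => ?_) hs⟩, rfl⟩⟩
        exact (hm _ (Finset.mem_image_of_mem _ hy)).trans_lt hj)
    have hRTs : ∀ j, k.Strong (Substructure.inclusion (hRT j)) := fun j =>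
      hk.strong_of_range_eq (hchain.2.1 j) _ (by
        rw [Substructure.coe_subtype, Subtype.range_coe]
        rfl)
    refine ⟨hchain.1, fun s h => ?_, fun f hf => hchain.2.2 f fun j => ?_⟩
    · obtain ⟨m, hm⟩ := (s.image e).exists_le
      obtain ⟨j, hj⟩ := exists_gt m
      have hs : ∀ y ∈ s, e y < j := fun y hy =>
        (hm _ (Finset.mem_image_of_mem _ hy)).trans_lt hj
      exact hk.strong_comp _ _ (hSRs j s hs) (hRTs j)
    · have h1 : k.Strong (f.comp (Substructure.inclusion (hRT j))) :=
        (IH j).2.2 _ fun s h => hf _ ((hSR j _ (hemb' j s)).trans (hRT j))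
      refine hk.strong_of_range_eq h1 _ ?_
      ext y
      constructor
      · rintro ⟨x, rfl⟩
        exact ⟨⟨_, ⟨x, rfl⟩⟩, rfl⟩
      · rintro ⟨⟨_, ⟨x, rfl⟩⟩, rfl⟩
        exact ⟨x, rfl⟩

theorem strong_inclusion {A : Type u} [L.Structure A] {S T : L.Substructure A} (h : S ≤ T)
    (hS : k.Strong S.subtype) (hT : k.Strong T.subtype) : k.Strong (Substructure.inclusion h) :=
  hk.coherence _ T.subtype hS hT

/-- A directed union of strong substructures of `A` is a strong substructure. -/
theorem strong_finset_union {A I : Type u} [L.Structure A] (S : Finset I → L.Substructure A)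
    (hS : Monotone S) (hstr : ∀ s, k.Strong (S s).subtype) (T : L.Substructure A)
    (hT : ∀ x, x ∈ T ↔ ∃ s, x ∈ S s) : k.Strong T.subtype :=
  (hk.finset_union _ I rfl S hS (fun _ _ _ => hk.strong_inclusion _ (hstr _) (hstr _)) T hT).2.2
    T.subtype fun s _ => hstr s

/-- A directed union of members of the class is in the class. -/
theorem mem_finset_union {A I : Type u} [L.Structure A] (S : Finset I → L.Substructure A)
    (hS : Monotone S) (hstr : ∀ s t (h : s ≤ t), k.Strong (Substructure.inclusion (hS h)))
    (hA : ∀ x, ∃ s, x ∈ S s) : k.Mem A ∧ ∀ s, k.Strong (S s).subtype := by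
  have h := hk.finset_union _ I rfl S hS hstr ⊤ fun x => ⟨fun _ => hA x, fun _ => trivial⟩
  exact ⟨hk.mem_of_equiv Substructure.topEquiv h.1, fun s =>
    hk.strong_comp _ Substructure.topEquiv.toEmbedding (h.2.1 s le_top)
      (hk.strong_of_equiv _ h.1)⟩

end FirstOrder.Language.AbstractClass.IsAEC

namespace FirstOrder.Language

/-! ### Quantifier-free types -/

section QFType

variable {L' : Language.{u, u}} {A B : Type u} [L'.Structure A] [L'.Structure B] {n : ℕ}

theorem qfType_eq_iff {x : Fin n → A} {y : Fin n → B} : qfType L' x = qfType L' y ↔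
    ∀ ψ : L'.Formula (Fin n), ψ.IsQF → (ψ.Realize x ↔ ψ.Realize y) := by
  simp only [qfType, Set.ext_iff, Set.mem_ofPred_eq]
  exact forall_congr' fun ψ => ⟨fun h hψ => by simpa [hψ] using h, fun h => by
    constructor <;> rintro ⟨h1, h2⟩
    exacts [⟨h1, (h h1).1 h2⟩, ⟨h1, (h h1).2 h2⟩]⟩

theorem qfType_comp_embedding (h : A ↪[L'] B) (x : Fin n → A) :
    qfType L' (fun i => h (x i)) = qfType L' x := by
  rw [qfType_eq_iff]
  intro ψ hψ
  have := hψ.realize_embedding (v := x) (xs := default) h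
  rw [Formula.Realize, Formula.Realize, ← this]
  exact iff_of_eq (congrArg _ (Subsingleton.elim _ _))

theorem exists_term_of_mem_closure_range {ι : Type*} {x : ι → A} {y : A}
    (hy : y ∈ Substructure.closure L' (Set.range x)) : ∃ t : L'.Term ι, t.realize x = y := by
  obtain ⟨t, rfl⟩ := Substructure.mem_closure_iff_exists_term.1 hy
  refine ⟨t.relabel fun z => z.2.choose, ?_⟩
  rw [Term.realize_relabel]
  congr 1
  funext z
  exact z.2.choose_spec

/-- Tuples with the same quantifier-free type generate isomorphic substructures. -/
theorem exists_embedding_of_qfType_eq {x : Fin n → A} {y : Fin n → B}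
    (h : qfType L' x = qfType L' y) :
    Nonempty (Substructure.closure L' (Set.range x) ↪[L'] B) := by
  rw [qfType_eq_iff] at h
  have heq : ∀ t₁ t₂ : L'.Term (Fin n), t₁.realize x = t₂.realize x ↔
      t₁.realize y = t₂.realize y := fun t₁ t₂ => by
    simpa using h (t₁.equal t₂) (BoundedFormula.IsAtomic.equal _ _).isQF
  -- The map evaluates at `y` a term chosen to name `z` over `x`. The choice is harmless because
  -- equalities between terms belong to the quantifier-free type.
  choose t ht using fun z : Substructure.closure L' (Set.range x) =>
    exists_term_of_mem_closure_range z.2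
  refine ⟨⟨⟨fun z => (t z).realize y, fun z w hzw => ?_⟩, fun {m} f z => ?_, fun {m} r z => ?_⟩⟩
  · rw [Subtype.ext_iff, ← ht z, ← ht w]
    exact (heq _ _).2 hzw
  · have : (t (Structure.funMap f z)).realize x = (Term.func f fun i => t (z i)).realize x := by
      rw [ht]
      simp only [Term.realize, ht]
      rfl
    exact (heq _ _).1 this
  · have := h (Relations.formula r fun i => t (z i)) (BoundedFormula.IsAtomic.rel _ _).isQF
    simp only [Formula.realize_rel, ht] at this
    exact this.symm

end QFType

/-! ### Templates realized by finite sequences -/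

namespace Template

variable {L' : Language.{u, u}}

/-- `Φ` is realized by arbitrarily long finite sequences in structures with property `P`. -/
def FinitelyRealized (Φ : Template L') (P : ∀ (N : Type u) [L'.Structure N], Prop) : Prop :=
  ∀ n : ℕ, ∃ (N : Type u) (_ : L'.Structure N) (b : Fin n → N), P N ∧ Nonempty N ∧
    Function.Injective b ∧ ∀ (m : ℕ) (t : Fin m → Fin n), StrictMono t →
      qfType L' (fun i => b (t i)) = Φ m

variable {Φ : Template L'} {P : ∀ (N : Type u) [L'.Structure N], Prop}

/-- Compactness by an ultraproduct over the finite subsets s of I: at s, a realizing sequence of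
length |s| interprets the elements of s in order. The limit tuples generate EM(I, Φ). -/
theorem FinitelyRealized.proper (h : Φ.FinitelyRealized P) : Φ.Proper := by
  classical
  intro I _
  choose N inst b _ hne hinj hb using h
  have : Nonempty (Finset I) := ⟨∅⟩
  let u : Ultrafilter (Finset I) := Ultrafilter.of Filter.atTop
  have hu : ∀ s : Finset I, ∀ᶠ s' in (u : Filter (Finset I)), s ⊆ s' := fun s =>
    Ultrafilter.of_le _ (Filter.eventually_ge_atTop s)
  let N' : Finset I → Type u := fun s => N s.card
  -- The arbitrary value for `i ∉ s` is immaterial: almost every `s` contains any given finite set.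
  let a' : I → ∀ s, N' s := fun i s =>
    if hi : i ∈ s then b s.card ((s.orderIsoOfFin rfl).symm ⟨i, hi⟩) else (hne s.card).some
  let A := (u : Filter (Finset I)).Product N'
  let a : I → A := fun i => (a' i : (u : Filter (Finset I)).Product N')
  have hinja : Function.Injective a := by
    intro i j hij
    have h1 : ∀ᶠ s in (u : Filter (Finset I)), a' i s = a' j s := Quotient.exact hij
    obtain ⟨s, h1, h2⟩ := (h1.and (hu {i, j})).exists
    have hi : i ∈ s := h2 (by simp)
    have hj : j ∈ s := h2 (by simp)
    simp only [a', dif_pos hi, dif_pos hj] at h1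
    simpa using (s.orderIsoOfFin rfl).symm.injective (hinj _ h1)
  have htype : ∀ (m : ℕ) (t : Fin m → I), StrictMono t →
      qfType L' (fun i => a (t i)) = Φ m := by
    intro m t ht
    have key : ∀ᶠ s in (u : Filter (Finset I)), qfType L' (fun i => a' (t i) s) = Φ m := by
      filter_upwards [hu (Finset.univ.image t)] with s hs
      have hts : ∀ i, t i ∈ s := fun i => hs (Finset.mem_image_of_mem _ (Finset.mem_univ i))
      rw [← hb s.card m (fun i => (s.orderIsoOfFin rfl).symm ⟨t i, hts i⟩)
        fun i j hij => (s.orderIsoOfFin rfl).symm.strictMono (ht hij)]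
      simp only [a', dif_pos (hts _)]
    ext ψ
    simp only [qfType, Set.mem_ofPred_eq]
    have hne' : ∀ s, Nonempty (N' s) := fun s => hne s.card
    have hlos : ψ.Realize (fun i => a (t i)) ↔
        ∀ᶠ s in (u : Filter (Finset I)), ψ.Realize fun i => a' (t i) s :=
      Ultraproduct.realize_formula_cast ψ fun i => a' (t i)
    rw [hlos, ← Filter.eventually_const (f := (u : Filter (Finset I))) (p := ψ ∈ Φ m),
      ← Filter.eventually_const (f := (u : Filter (Finset I))) (p := ψ.IsQF),
      ← Filter.eventually_and]
    refine Filter.eventually_congr ?_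
    filter_upwards [key] with s hs
    rw [← hs]
    rfl
  -- The ultraproduct need not be generated by the skeleton; the generated substructure keeps the
  -- quantifier-free types.
  let S := Substructure.closure L' (Set.range a)
  refine ⟨S, inferInstance, fun i => ⟨a i, Substructure.subset_closure ⟨i, rfl⟩⟩,
    fun i j hij => hinja (congrArg Subtype.val hij), ?_, fun m t ht => ?_⟩
  · refine eq_top_iff.2 fun x _ => ?_
    obtain ⟨t, ht⟩ := exists_term_of_mem_closure_range x.2
    have : x = t.realize fun i => (⟨a i, Substructure.subset_closure ⟨i, rfl⟩⟩ : S) := by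
      apply S.subtype_injective
      rw [← HomClass.realize_term S.subtype]
      exact ht.symm
    rw [this]
    exact t.realize_mem _ fun i => Substructure.subset_closure ⟨i, rfl⟩
  · rw [← htype m t ht]
    exact (qfType_comp_embedding S.subtype _).symm

/-- The type of a finite increasing tuple determines what it generates, so finite parts of EM(I, Φ)
can be compared with structures satisfying `P`, although EM(I, Φ) is not yet known to satisfy `P`.
-/
theorem FinitelyRealized.exists_embedding (h : Φ.FinitelyRealized P) {I A : Type u}
    [LinearOrder I] [L'.Structure A] {a : I → A} (hA : Φ.IsEM I A a) (s : Finset I) :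
    ∃ (N : Type u) (_ : L'.Structure N), P N ∧
      Nonempty (Substructure.closure L' (a '' s) ↪[L'] N) := by
  obtain ⟨N, inst, b, hN, -, -, hb⟩ := h s.card
  refine ⟨N, inst, hN, ?_⟩
  have h1 := hA.qfType_eq s.card (s.orderEmbOfFin rfl) (s.orderEmbOfFin rfl).strictMono
  rw [← hb s.card id strictMono_id] at h1
  have h2 := exists_embedding_of_qfType_eq h1
  have h3 : (Set.range fun i => a (s.orderEmbOfFin rfl i)) = a '' s := by
    rw [← Finset.range_orderEmbOfFin s rfl, ← Set.range_comp]
    rfl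
  rwa [h3] at h2

theorem IsEM.exists_mem_closure {I A : Type u} [LinearOrder I] [L'.Structure A] {a : I → A}
    (hA : Φ.IsEM I A a) (x : A) : ∃ s : Finset I, x ∈ Substructure.closure L' (a '' s) := by
  classical
  have hx : x ∈ Substructure.closure L' (Set.range a) := hA.generates ▸ Substructure.mem_top x
  obtain ⟨t, rfl⟩ := exists_term_of_mem_closure_range hx
  refine ⟨t.varFinset, ?_⟩
  rw [← Term.realize_restrictVar' (s := ↑t.varFinset) subset_rfl]
  exact Term.realize_mem _ _ fun i => Substructure.subset_closure ⟨i.1, i.2, rfl⟩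

end Template

/-! ### Expansions in which closed sets are strong submodels -/

variable {L L' : Language.{u, u}}

/-- Forgetting symbols commutes with passing to a substructure. -/
def Substructure.reductEquiv (φ : L →ᴸ L') {A : Type u} [L'.Structure A] (T : L'.Substructure A) :
    letI := φ.reduct A; letI := φ.reduct T; T ≃[L] φ.substructureReduct T :=
  letI := φ.reduct A
  letI := φ.reduct T
  { toFun := fun x => ⟨x.1, x.2⟩
    invFun := fun x => ⟨x.1, x.2⟩
    left_inv := fun _ => rfl
    right_inv := fun _ => rfl
    map_fun' := fun _ _ => rfl
    map_rel' := fun _ _ => Iff.rfl }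

namespace AbstractClass.IsAEC

variable {k : AbstractClass L} (hk : k.IsAEC) {φ : L →ᴸ L'} {A B : Type u} [L'.Structure A]
  [L'.Structure B]

include hk

theorem strong_reductAlong {h : B ↪[L'] A} (hr : k.StrongReduct φ (Set.range h)) :
    letI := φ.reduct A; letI := φ.reduct B; k.Strong (h.reductAlong φ) := by
  let := φ.reduct A
  let := φ.reduct B
  obtain ⟨S, hS, hs⟩ := hr
  refine hk.strong_of_range_eq hs _ ?_
  rw [Substructure.coe_subtype, Subtype.range_coe]
  exact hS

/-- Coherence: the images of `X` and of `B` are both strong in `A`, and the first lies in the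
second. -/
theorem strongReduct_of_embedding {h : B ↪[L'] A} (hr : k.StrongReduct φ (Set.range h))
    {X : Set B} (hX : k.StrongReduct φ (h '' X)) : k.StrongReduct φ X := by
  have hstr := hk.strong_reductAlong hr
  let := φ.reduct A
  let := φ.reduct B
  obtain ⟨S, hS, hs⟩ := hX
  have hmem : ∀ x : B, x ∈ S.comap (h.reductAlong φ).toHom ↔ x ∈ X := fun x => by
    have h1 : h x ∈ (S : Set A) ↔ x ∈ X := by rw [hS]; exact h.injective.mem_set_image
    exact h1
  refine ⟨S.comap (h.reductAlong φ).toHom, Set.ext hmem,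
    hk.coherence _ (h.reductAlong φ) (hk.strong_of_range_eq hs _ ?_) hstr⟩
  rw [Substructure.coe_subtype, Subtype.range_coe, hS]
  ext y
  constructor
  · rintro ⟨x, hx, rfl⟩
    exact ⟨⟨x, (hmem x).2 hx⟩, rfl⟩
  · rintro ⟨x, rfl⟩
    exact ⟨x.1, (hmem _).1 x.2, rfl⟩

theorem strongReduct_image_of_strong {T : L'.Substructure A}
    (hT : k.StrongReduct φ (T : Set A)) {X : Set T} (hX : k.StrongReduct φ X) :
    k.StrongReduct φ ((↑) '' X : Set A) := by
  have hT' : k.StrongReduct φ (Set.range T.subtype) := by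
    rwa [Substructure.coe_subtype, Subtype.range_coe]
  have hstr := hk.strong_reductAlong hT'
  let := φ.reduct A
  let := φ.reduct T
  obtain ⟨S, hS, hs⟩ := hX
  refine ⟨S.map (T.subtype.reductAlong φ).toHom, ?_, ?_⟩
  · rw [← hS]
    rfl
  · refine hk.strong_of_range_eq (hk.strong_comp _ _ hs hstr) _ ?_
    ext y
    constructor
    · rintro ⟨x, rfl⟩
      exact ⟨⟨_, ⟨x.1, x.2, rfl⟩⟩, rfl⟩
    · rintro ⟨⟨_, ⟨x, hx, rfl⟩⟩, rfl⟩
      exact ⟨⟨x, hx⟩, rfl⟩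

theorem memReduct_of_strongReduct_range {h : B ↪[L'] A} (hr : k.StrongReduct φ (Set.range h)) :
    k.MemReduct φ B := by
  have hstr := hk.strong_reductAlong hr
  let := φ.reduct A
  let := φ.reduct B
  exact (hk.mem_of_strong _ hstr).1

end AbstractClass.IsAEC

open Template

/-! ### Sets closed under the functions other than the names of elements of M -/

section Names

variable {M : Type u} {ψ : L[[M]] →ᴸ L'} {A B : Type u} [L'.Structure A] [L'.Structure B]

theorem map_nameOf (h : B ↪[L'] A) (m : M) : h (nameOf ψ m : L'.Constants) =
    ((nameOf ψ m : L'.Constants) : A) :=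
  h.map_constants _

/-- Closure under unnamed functions thus includes closure under all functions of `L`, so closed sets
are `L`-substructures. -/
theorem onFunction_ne_nameOf (hψ : ψ.Injective) {n : ℕ} (f : L.Functions n) (m : M) :
    (⟨n, (ψ.comp (L.lhomWithConstants M)).onFunction f⟩ : Σ l, L'.Functions l) ≠
      ⟨0, nameOf ψ m⟩ := by
  intro h
  obtain ⟨rfl, h⟩ := Sigma.mk.inj_iff.1 h
  have := hψ.onFunction (eq_of_heq h)
  exact Sum.inl_ne_inr this

theorem Template.ClosedUnderUnnamed.of_substructure (S : L'.Substructure A) :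
    ClosedUnderUnnamed ψ (S : Set A) :=
  fun _ f _ => S.fun_mem f

theorem Template.ClosedUnderUnnamed.univ : ClosedUnderUnnamed ψ (Set.univ : Set A) :=
  fun _ _ _ _ _ => trivial

theorem Template.ClosedUnderUnnamed.image {X : Set B} (hX : ClosedUnderUnnamed ψ X) (h : B ↪[L'] A) :
    ClosedUnderUnnamed ψ (h '' X) := by
  intro n f hf x hx
  choose y hy hyx using hx
  obtain rfl : (fun i => h (y i)) = x := funext hyx
  exact ⟨_, hX n f hf y hy, h.map_fun f y⟩

theorem Template.ClosedUnderUnnamed.preimage {X : Set A} (hX : ClosedUnderUnnamed ψ X) (h : B ↪[L'] A) :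
    ClosedUnderUnnamed ψ (h ⁻¹' X) := by
  intro n f hf x hx
  have := hX n f hf (h ∘ x) hx
  rwa [← h.map_fun] at this

/-- The substructure of the reduct of `A` on a closed set. -/
def Template.ClosedUnderUnnamed.toSubstructure (hψ : ψ.Injective) {X : Set A}
    (hX : ClosedUnderUnnamed ψ X) :
    letI := (ψ.comp (L.lhomWithConstants M)).reduct A; L.Substructure A :=
  letI := (ψ.comp (L.lhomWithConstants M)).reduct A
  { carrier := X
    fun_mem := fun f => hX _ _ (onFunction_ne_nameOf hψ f) }

end Names

/-- `A` is an expansion of a member of `k_M` in which all sets closed under the functions other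
than the names of elements of `M` are strong submodels, and which has `M` as a substructure. -/
structure ClosedStrong (k : AbstractClass L) {M : Type u} [L.Structure M] (ψ : L[[M]] →ᴸ L')
    (A : Type u) [L'.Structure A] : Prop where
  mem : k.MemReduct (ψ.comp (L.lhomWithConstants M)) A
  strong : ∀ X : Set A, X.Nonempty → ClosedUnderUnnamed ψ X →
    k.StrongReduct (ψ.comp (L.lhomWithConstants M)) X
  closed_names : ∀ {n : ℕ} (f : L'.Functions n),
    ClosedUnder f (Set.range fun m : M => ((nameOf ψ m : L'.Constants) : A))
  exists_embedding : letI := (ψ.comp (L.lhomWithConstants M)).reduct A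
    ∃ f : M ↪[L] A, ∀ m, f m = ((nameOf ψ m : L'.Constants) : A)

/-! ### Preservation under substructures and directed unions -/

namespace ClosedStrong

variable {k : AbstractClass L} (hk : k.IsAEC) {M : Type u} [L.Structure M] [Nonempty M]
  {ψ : L[[M]] →ᴸ L'} {A B : Type u} [L'.Structure A] [L'.Structure B]

-- Closed sets of `B` have closed images in `A`, and the image of `B` is itself closed. Both are
-- therefore strong in `A`, and coherence brings this back to `B`.
include hk in
theorem of_embedding (hA : ClosedStrong k ψ A) (h : B ↪[L'] A) : ClosedStrong k ψ B := by
  have hne : Nonempty B := ⟨((nameOf ψ (Classical.arbitrary M) : L'.Constants) : B)⟩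
  have hr : k.StrongReduct (ψ.comp (L.lhomWithConstants M)) (Set.range h) :=
    hA.strong _ (Set.range_nonempty _) (by
      rw [← Set.image_univ]
      exact ClosedUnderUnnamed.univ.image h)
  refine ⟨hk.memReduct_of_strongReduct_range hr, fun X hX hc =>
    hk.strongReduct_of_embedding hr (hA.strong _ (hX.image h) (hc.image h)), ?_, ?_⟩
  · intro n f x hx
    choose m hm using hx
    obtain rfl := funext hm
    obtain ⟨m', hm'⟩ := hA.closed_names f (fun i => ((nameOf ψ (m i) : L'.Constants) : A))
      fun i => ⟨m i, rfl⟩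
    refine ⟨m', h.injective ?_⟩
    dsimp only at hm' ⊢
    rw [map_nameOf, hm', h.map_fun]
    congr 1
    funext i
    exact (map_nameOf h _).symm
  · obtain ⟨g, hg⟩ := hA.exists_embedding
    let := (ψ.comp (L.lhomWithConstants M)).reduct A
    let := (ψ.comp (L.lhomWithConstants M)).reduct B
    have hg' : ∀ m, g m = h (nameOf ψ m : L'.Constants) := fun m => by rw [hg, map_nameOf]
    refine ⟨⟨⟨fun m => ((nameOf ψ m : L'.Constants) : B), fun m m' hm => ?_⟩, fun {n} f x => ?_,
      fun {n} r x => ?_⟩, fun m => rfl⟩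
    · apply g.injective
      rw [hg', hg']
      exact congrArg h hm
    · apply h.injective
      refine (hg' _).symm.trans ((g.map_fun f x).trans ?_)
      refine Eq.trans ?_ ((h.reductAlong (ψ.comp (L.lhomWithConstants M))).map_fun f _).symm
      congr 1
      exact funext fun i => hg' (x i)
    · refine ((h.reductAlong (ψ.comp (L.lhomWithConstants M))).map_rel r _).symm.trans
        (Iff.trans (iff_of_eq ?_) (g.map_rel r x))
      congr 1
      exact funext fun i => (hg' (x i)).symm

-- A closed set `X` is the directed union of its traces on the members of the system. Each trace is
-- strong in its member, and each member is strong in `A`.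
include hk in
theorem of_finset_union (hψ : ψ.Injective) {I : Type u} (S : Finset I → L'.Substructure A)
    (hS : Monotone S) (hA : ∀ x, ∃ s, x ∈ S s) (h : ∀ s, ClosedStrong k ψ (S s)) :
    ClosedStrong k ψ A := by
  classical
  have hne : ∀ s, Nonempty (S s) := fun s =>
    ⟨((nameOf ψ (Classical.arbitrary M) : L'.Constants) : S s)⟩
  have hmem : k.MemReduct (ψ.comp (L.lhomWithConstants M)) A ∧
      ∀ s, k.StrongReduct (ψ.comp (L.lhomWithConstants M)) (S s : Set A) := by
    let φ := ψ.comp (L.lhomWithConstants M)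
    let := φ.reduct A
    have := hk.mem_finset_union (fun s => φ.substructureReduct (S s))
      (fun s t hst => φ.substructureReduct.monotone (hS hst)) (fun s t hst => by
        let := φ.reduct (S t)
        obtain ⟨R, hR, hr⟩ := (h t).strong (Set.range (Substructure.inclusion (hS hst)))
          (Set.range_nonempty _) (by
            rw [← Set.image_univ]
            exact ClosedUnderUnnamed.univ.image _)
        refine hk.strong_of_range_eq (hk.strong_comp _ _ hr
          (hk.strong_of_equiv (Substructure.reductEquiv φ (S t)) (h t).mem)) _ ?_
        ext y
        constructor
        · rintro ⟨x, rfl⟩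
          have hx : x.1 ∈ (R : Set _) := x.2
          rw [hR] at hx
          obtain ⟨z, hz⟩ := hx
          refine ⟨⟨z.1, z.2⟩, ?_⟩
          have := congrArg Subtype.val hz
          exact Subtype.ext this
        · rintro ⟨x, rfl⟩
          have hx : (⟨x.1, hS hst x.2⟩ : S t) ∈ (R : Set _) := by
            rw [hR]
            exact ⟨⟨x.1, x.2⟩, rfl⟩
          exact ⟨⟨_, hx⟩, rfl⟩) hA
    exact ⟨this.1, fun s => ⟨_, φ.coe_substructureReduct, this.2 s⟩⟩
  refine ⟨hmem.1, fun X hX hc => ?_, fun {n} f x hx => ?_, ?_⟩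
  · obtain ⟨x₀, hx₀⟩ := hX
    obtain ⟨s₀, hs₀⟩ := hA x₀
    -- Adjoining `s₀` puts `x₀` in every trace: only nonempty closed sets are known to be strong.
    have h1 : ∀ s, k.StrongReduct (ψ.comp (L.lhomWithConstants M))
        ((↑) '' ((↑) ⁻¹' X : Set (S (s ∪ s₀))) : Set A) := fun s =>
      hk.strongReduct_image_of_strong (hmem.2 _) ((h _).strong _
        ⟨⟨x₀, hS Finset.subset_union_right hs₀⟩, hx₀⟩ (hc.preimage (S (s ∪ s₀)).subtype))
    let := (ψ.comp (L.lhomWithConstants M)).reduct A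
    choose R hR hr using h1
    have hR' : ∀ s x, x ∈ R s ↔ x ∈ X ∧ x ∈ S (s ∪ s₀) := fun s x => by
      rw [← SetLike.mem_coe, hR]
      simp [and_comm]
    refine ⟨hc.toSubstructure hψ, rfl, hk.strong_finset_union R (fun s t hst x => ?_) hr _
      fun x => ?_⟩
    · rw [hR', hR']
      exact And.imp_right fun hx => hS (Finset.union_subset_union_left hst) hx
    · constructor
      · intro hx
        obtain ⟨s, hs⟩ := hA x
        exact ⟨s, (hR' s x).2 ⟨hx, hS Finset.subset_union_left hs⟩⟩
      · rintro ⟨s, hs⟩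
        exact ((hR' s x).1 hs).1
  · choose m hm using hx
    obtain rfl := funext hm
    obtain ⟨m', hm'⟩ := (h ∅).closed_names f
      (fun i => ((nameOf ψ (m i) : L'.Constants) : S ∅)) fun i => ⟨m i, rfl⟩
    refine ⟨m', ?_⟩
    dsimp only at hm' ⊢
    rw [← map_nameOf (S ∅).subtype, hm', (S ∅).subtype.map_fun]
    congr 1
    funext i
    exact map_nameOf (S ∅).subtype _
  · obtain ⟨g, hg⟩ := (h ∅).exists_embedding
    let := (ψ.comp (L.lhomWithConstants M)).reduct A
    let := (ψ.comp (L.lhomWithConstants M)).reduct (S ∅)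
    refine ⟨((S ∅).subtype.reductAlong (ψ.comp (L.lhomWithConstants M))).comp g, fun m => ?_⟩
    rw [Embedding.comp_apply, hg]
    exact map_nameOf (S ∅).subtype m

include hk in
theorem of_isEM (hψ : ψ.Injective) {Φ : Template L'}
    (hΦ : Φ.FinitelyRealized fun N _ => ClosedStrong k ψ N) {I : Type u} [LinearOrder I]
    {a : I → A} (hA : Φ.IsEM I A a) : ClosedStrong k ψ A := by
  refine of_finset_union hk hψ (fun s : Finset I => Substructure.closure L' (a '' s))
    (fun s t hst => Substructure.closure_mono (Set.image_mono hst)) hA.exists_mem_closure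
    fun s => ?_
  obtain ⟨N, _, hN, ⟨e⟩⟩ := hΦ.exists_embedding hA s
  exact of_embedding hk hN e

end ClosedStrong

variable {L : Language.{u, u}}

open Template

/-! ### Expanding models by functions enumerating strong submodels -/

/-- `M`-many function symbols in each positive arity. -/
def enumLanguage (M : Type u) : Language.{u, u} :=
  ⟨fun n => {_m : M // n ≠ 0}, fun _ => PEmpty⟩

/-- The vocabulary `L[[M]]` with `M`-many new function symbols in each positive arity. -/
abbrev withEnum (L : Language.{u, u}) (M : Type u) : Language.{u, u} := L[[M]].sum (enumLanguage M)

/-- The inclusion of `L[[M]]` in `L.withEnum M`. -/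
abbrev lhomWithEnum (L : Language.{u, u}) (M : Type u) : L[[M]] →ᴸ L.withEnum M := LHom.sumInl

variable {M : Type u}

theorem lhomWithEnum_injective : (L.lhomWithEnum M).Injective := LHom.sumInl_injective

theorem card_withEnum_le {κ : Cardinal.{u}} (hM : #M = κ) (hκ : ℵ₀ ≤ κ) (hL : L.card ≤ κ) :
    (L.withEnum M).card ≤ κ := by
  have h1 : (enumLanguage M).card ≤ κ := by
    rw [card_eq_card_functions_add_card_relations]
    refine add_le_of_le hκ ?_ ?_
    · refine (sum_le_sum _ (fun _ => κ) fun n => ?_).trans ?_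
      · rw [lift_id]
        exact (mk_subtype_le _).trans hM.le
      · simp [hκ]
    · simp [enumLanguage]
  rw [card_sum, card_withConstants]
  simp only [lift_id]
  exact add_le_of_le hκ (add_le_of_le hκ hL hM.le) h1

namespace AbstractClass.IsAEC

variable {k : AbstractClass L} (hk : k.IsAEC) [L.Structure M]

include hk

/-- Every finite subset of `N` lies in a strong submodel of `N`, monotonically, and in `M` itself
when this is possible. -/
theorem exists_monotone_strong {κ : Cardinal.{u}} (hκ : k.lst ≤ κ) (hM : #M = κ) {N : Type u}
    [L.Structure N] (f : M ↪[L] N) (hf : k.Strong f) :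
    ∃ G : Finset N → L.Substructure N, Monotone G ∧ (∀ s : Finset N, ↑s ⊆ (G s : Set N)) ∧
      (∀ s, k.Strong (G s).subtype) ∧ (∀ s, #(G s) ≤ κ) ∧ (∀ s, Set.range f ⊆ G s) ∧
      ∀ s : Finset N, ↑s ⊆ Set.range f → (G s : Set N) = Set.range f := by
  classical
  have hlst : k.IsLSTBound k.lst := csInf_mem hk.exists_isLSTBound
  have hκ₀ : ℵ₀ ≤ κ := hlst.1.trans hκ
  choose op hsub hstr hcard using hlst.2 N (hk.mem_of_strong f hf).2
  -- Monotonicity is forced by including `G t` for all proper subsets `t`. The exceptional value on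
  -- subsets of the image of `M` is what later keeps `M` closed under the new functions.
  let G : Finset N → L.Substructure N := Finset.strongInduction fun s ih =>
    if (s : Set N) ⊆ Set.range f then f.toHom.range else
      op ((s : Set N) ∪ Set.range f ∪ ⋃ t : {t : Finset N // t ∈ s.ssubsets},
        (ih t.1 (Finset.mem_ssubsets.1 t.2) : Set N))
  have hG : ∀ s, G s = if (s : Set N) ⊆ Set.range f then f.toHom.range else
      op ((s : Set N) ∪ Set.range f ∪ ⋃ t : {t : Finset N // t ∈ s.ssubsets}, (G t.1 : Set N)) := fun s =>
    Finset.strongInduction_eq _ s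
  have hpos : ∀ s : Finset N, ↑s ⊆ Set.range f → (G s : Set N) = Set.range f := fun s hs => by
    rw [hG, if_pos hs]
    exact Hom.range_coe _
  have hneg : ∀ s : Finset N, ¬ ↑s ⊆ Set.range f →
      ((s : Set N) ∪ Set.range f ∪ ⋃ t : {t : Finset N // t ∈ s.ssubsets}, (G t.1 : Set N)) ⊆
        (G s : Set N) := fun s hs => by
    conv_rhs => rw [hG, if_neg hs]
    exact hsub _
  have hrange : ∀ s, Set.range f ⊆ G s := fun s => by
    by_cases hs : (s : Set N) ⊆ Set.range f
    · exact (hpos s hs).ge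
    · exact fun x hx => hneg s hs (Or.inl (Or.inr hx))
  refine ⟨G, fun t s hts => ?_, fun s => ?_, fun s => ?_, fun s => ?_, hrange, hpos⟩
  · rcases eq_or_ssubset_of_subset hts with rfl | hlt
    · exact le_rfl
    · by_cases hs : (s : Set N) ⊆ Set.range f
      · intro x hx
        have ht : (t : Set N) ⊆ Set.range f := (Finset.coe_subset.2 hts).trans hs
        rw [← SetLike.mem_coe, hpos t ht] at hx
        exact hrange s hx
      · exact fun x hx => hneg s hs (Or.inr (Set.mem_iUnion.2
          ⟨⟨t, Finset.mem_ssubsets.2 hlt⟩, hx⟩))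
  · by_cases hs : (s : Set N) ⊆ Set.range f
    · rwa [hpos s hs]
    · exact fun x hx => hneg s hs (Or.inl (Or.inl hx))
  · by_cases hs : (s : Set N) ⊆ Set.range f
    · refine hk.strong_of_range_eq hf _ ?_
      rw [Substructure.coe_subtype, Subtype.range_coe]
      exact (hpos s hs).symm
    · rw [hG, if_neg hs]
      exact hstr _
  · have hrangecard : #(Set.range f) ≤ κ := mk_range_le.trans hM.le
    induction s using Finset.strongInduction with
    | H s ih =>
    by_cases hs : (s : Set N) ⊆ Set.range f
    · have : #(G s : Set N) ≤ κ := by rwa [hpos s hs]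
      exact this
    · rw [hG, if_neg hs]
      refine (hcard _).trans (add_le_of_le hκ₀ ?_ hκ)
      refine (mk_union_le _ _).trans (add_le_of_le hκ₀ ((mk_union_le _ _).trans
        (add_le_of_le hκ₀ ?_ hrangecard)) ?_)
      · exact mk_le_aleph0.trans hκ₀
      · refine (mk_iUnion_le _).trans ?_
        refine (mul_le_mul' (mk_le_aleph0.trans hκ₀) (ciSup_le' fun t => ?_)).trans
          (mul_eq_self hκ₀).le
        exact ih t.1 (Finset.mem_ssubsets.1 t.2)

/-- Every strong extension of `M` has an expansion in which closed sets are strong submodels. -/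
theorem exists_closedStrong [Nonempty M] {κ : Cardinal.{u}} (hκ : k.lst ≤ κ) (hM : #M = κ)
    {N : Type u} [L.Structure N] (f : M ↪[L] N) (hf : k.Strong f) :
    ∃ _ : (L.withEnum M).Structure N, ClosedStrong k (L.lhomWithEnum M) N := by
  classical
  obtain ⟨G, hmono, hsub, hstr, hcard, hrange, hpos⟩ := hk.exists_monotone_strong hκ hM f hf
  -- `M` can serve as the index set since |G(s)| ≤ κ = |M|.
  have hen : ∀ s, ∃ e : M → N, Set.range e = G s := fun s => by
    have : Nonempty (G s) := ⟨⟨_, hrange s ⟨Classical.arbitrary M, rfl⟩⟩⟩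
    obtain ⟨i⟩ := (le_def (G s) M).1 ((hcard s).trans hM.ge)
    refine ⟨fun m => (Function.invFun i m : G s), ?_⟩
    rw [show (fun m => ((Function.invFun i m : G s) : N)) = Subtype.val ∘ Function.invFun i from rfl,
      (Function.invFun_surjective i.injective).range_comp, Subtype.range_coe]
  choose en hen using hen
  let : (constantsOn M).Structure N := constantsOn.structure f
  let : (enumLanguage M).Structure N :=
    { funMap := fun i x => en (Finset.univ.image x) i.1
      RelMap := fun r => r.elim }
  refine ⟨inferInstance, (hk.mem_of_strong f hf).2, fun X hX hc => ?_, fun {n} F x hx => ?_,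
    ⟨f, fun m => rfl⟩⟩
  · obtain ⟨x₀, hx₀⟩ := hX
    -- Listing `s` as a tuple of length |s| exhibits all of `G s` as values of the new functions.
    -- Nonemptiness is needed because there are none of arity zero.
    have key : ∀ s : Finset N, s.Nonempty → ↑s ⊆ X → (G s : Set N) ⊆ X := by
      intro s hs hsX y hy
      rw [← hen] at hy
      obtain ⟨m, rfl⟩ := hy
      have hx : Finset.univ.image (fun i => (s.equivFin.symm i : N)) = s := by
        ext z
        simp only [Finset.mem_image, Finset.mem_univ, true_and]
        exact ⟨fun ⟨i, hi⟩ => hi ▸ (s.equivFin.symm i).2, fun hz =>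
          ⟨s.equivFin ⟨z, hz⟩, by simp⟩⟩
      have := hc s.card (Sum.inr ⟨m, hs.card_pos.ne'⟩) (by
        intro m h
        have h0 := congrArg Sigma.fst h
        exact hs.card_pos.ne' h0) (fun i => (s.equivFin.symm i : N))
        fun i => hsX (s.equivFin.symm i).2
      have e : (Structure.funMap (L := L.withEnum M) (Sum.inr ⟨m, hs.card_pos.ne'⟩)
        fun i => (s.equivFin.symm i : N)) = en s m := by
        conv_rhs => rw [← hx]
        rfl
      rwa [e] at this
    have hS : ∀ s : Finset X, (G (insert x₀ (s.map (Function.Embedding.subtype _))) : Set N) ⊆ X := by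
      intro s
      refine key _ (Finset.insert_nonempty _ _) ?_
      intro y hy
      simp only [Finset.coe_insert, Set.mem_insert_iff, Finset.coe_map, Set.mem_image] at hy
      rcases hy with rfl | ⟨z, -, rfl⟩
      exacts [hx₀, z.2]
    refine ⟨hc.toSubstructure lhomWithEnum_injective, rfl, hk.strong_finset_union
      (fun s : Finset X => G (insert x₀ (s.map (Function.Embedding.subtype _))))
      (fun s t hst => hmono (Finset.insert_subset_insert _ (Finset.map_subset_map.2 hst)))
      (fun s => hstr _) _ fun x => ⟨fun hx => ⟨{⟨x, hx⟩}, hsub _ (by simp)⟩, fun ⟨s, hs⟩ =>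
        hS s hs⟩⟩
  · have hname : ∀ m : M, ((nameOf (L.lhomWithEnum M) m : (L.withEnum M).Constants) : N) = f m :=
      fun m => rfl
    simp only [hname] at hx ⊢
    rcases F with (F | F) | F
    · choose m hm using hx
      obtain rfl := funext hm
      exact ⟨Structure.funMap F m, f.map_fun F m⟩
    · match n, F with
      | 0, c => exact ⟨c, rfl⟩
    · have : (↑(Finset.univ.image x) : Set N) ⊆ Set.range f := by
        intro y hy
        simp only [Finset.coe_image, Set.mem_image] at hy
        obtain ⟨i, -, rfl⟩ := hy
        exact hx i
      have h2 : en (Finset.univ.image x) F.1 ∈ Set.range (en (Finset.univ.image x)) := ⟨_, rfl⟩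
      rw [hen, hpos _ this] at h2
      exact h2

end AbstractClass.IsAEC

namespace Template

variable {L' : Language.{u, u}}

/-! ### Existence of templates -/

theorem card_set_formula_le {κ : Cardinal.{u}} (hκ : ℵ₀ ≤ κ) (hL' : L'.card ≤ κ) (n : ℕ) :
    #(Set (L'.Formula (Fin n))) ≤ 2 ^ κ := by
  rw [mk_set]
  refine power_le_power_left two_ne_zero ?_
  have h1 : #(L'.Formula (Fin n)) ≤ #(Σ m, L'.BoundedFormula (Fin n) m) :=
    mk_le_of_injective (f := Sigma.mk 0) sigma_mk_injective
  refine h1.trans (BoundedFormula.card_le.trans (max_le hκ ?_))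
  rw [mk_fin, lift_natCast, lift_uzero]
  exact add_le_of_le hκ ((natCast_lt_aleph0).le.trans hκ) hL'

/-- For all `α < θ`, there is a sequence of length at least `ℶ_ α` in a structure with property `P`,
all of whose increasing `m`-tuples have type `p m` for `m < n`. -/
def LargelyRealized (θ : Ordinal.{u}) (P : ∀ (N : Type u) [L'.Structure N], Prop) (n : ℕ)
    (p : Template L') : Prop :=
  ∀ α < θ, ∃ (N : Type u) (_ : L'.Structure N) (W : Type u) (_ : LinearOrder W) (b : W → N),
    P N ∧ Function.Injective b ∧ ℶ_ α ≤ #W ∧ ∀ m < n, ∀ t : Fin m → W, StrictMono t →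
      qfType L' (fun i => b (t i)) = p m

variable {P : ∀ (N : Type u) [L'.Structure N], Prop} {κ : Cardinal.{u}}

/-- If each candidate type for n-tuples failed at some ordinal below (2^κ)⁺, regularity would bound
these at most 2^κ ordinals by a single β below it. Erdős–Rado, applied to the colouring of n-sets by
types on a longer sequence, gives a homogeneous set of size above ℶ_β, whose type did not fail. -/
theorem LargelyRealized.exists_succ (hκ : ℵ₀ ≤ κ) (hL' : L'.card ≤ κ) {n : ℕ} {p : Template L'}
    (h : LargelyRealized (Order.succ ((2 : Cardinal.{u}) ^ κ)).ord P n p) :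
    ∃ q : Template L', (∀ m < n, q m = p m) ∧
      LargelyRealized (Order.succ ((2 : Cardinal.{u}) ^ κ)).ord P (n + 1) q := by
  classical
  have h2κ : ℵ₀ ≤ (2 : Cardinal.{u}) ^ κ := hκ.trans (cantor κ).le
  by_contra hcon
  push Not at hcon
  have hbad : ∀ c : Set (L'.Formula (Fin n)),
      ¬ LargelyRealized (Order.succ ((2 : Cardinal.{u}) ^ κ)).ord P (n + 1)
        (Function.update p n c) := fun c =>
    hcon _ fun m hm => Function.update_of_ne hm.ne _ _
  simp only [LargelyRealized] at hbad
  simp only [not_forall] at hbad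
  choose a ha hbad using hbad
  have hsup : ⨆ c, a c < (Order.succ ((2 : Cardinal.{u}) ^ κ)).ord := by
    refine Ordinal.iSup_lt_of_lt_cof ?_ ha
    rw [(isRegular_succ h2κ).cof_ord]
    exact (card_set_formula_le hκ hL' n).trans_lt (Order.lt_succ _)
  have hlim := isSuccLimit_ord (h2κ.trans (Order.le_succ ((2 : Cardinal.{u}) ^ κ)))
  -- The second term ensures that there are at most ℶ_β colours.
  let β := max (⨆ c, a c) ((2 : Cardinal.{u}) ^ κ).ord
  have hβ : β < (Order.succ ((2 : Cardinal.{u}) ^ κ)).ord :=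
    max_lt hsup (ord_lt_ord.2 (Order.lt_succ _))
  have hβn : ∀ m : ℕ, β + m < (Order.succ ((2 : Cardinal.{u}) ^ κ)).ord := fun m => by
    induction m with
    | zero => simpa using hβ
    | succ m ih =>
      rw [Nat.cast_add, Nat.cast_one, ← add_assoc]
      exact hlim.succ_lt ih
  have hCβ : #(Set (L'.Formula (Fin n))) ≤ ℶ_ β :=
    (card_set_formula_le hκ hL' n).trans
      ((le_beth_ord _).trans (beth_mono (le_max_right _ _)))
  -- Using n + 1 rather than n supplies the strict inequality ℶ_(β + n) < |W| needed for Erdős–Rado.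
  obtain ⟨N, inst, W, _, b, hN, hb, hW, hp⟩ := h _ (hβn (n + 1))
  obtain ⟨Z, hZ, c, hc⟩ := ErdosRado.exists_homogeneous β hCβ n W
    (fun s => if hs : s.card = n then qfType L' (fun i => b (s.orderEmbOfFin hs i)) else ∅)
    (lt_of_lt_of_le (beth_strictMono (by
      rw [Nat.cast_add, Nat.cast_one, ← add_assoc]
      exact Order.lt_succ _)) hW)
  refine hbad c ⟨N, inst, Z, inferInstance, fun z => b z, hN,
    hb.comp Subtype.val_injective, ?_, fun m hm t ht => ?_⟩
  · exact (beth_mono ((Ordinal.le_iSup a c).trans (le_max_left _ _))).trans hZ.le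
  · rcases (Nat.lt_succ_iff.1 hm).lt_or_eq with hlt | rfl
    · rw [Function.update_of_ne hlt.ne]
      exact hp m hlt (fun i => t i) ht
    · rw [Function.update_self]
      have ht' : StrictMono fun i => (t i : W) := ht
      have hcard : (Finset.univ.image fun i => (t i : W)).card = m := by
        rw [Finset.card_image_of_injective _ ht'.injective, Finset.card_univ, Fintype.card_fin]
      rw [← hc (Finset.univ.image fun i => (t i : W)) (by
        intro y hy
        simp only [Finset.coe_image, Set.mem_image] at hy
        obtain ⟨i, -, rfl⟩ := hy
        exact (t i).2) hcard, dif_pos hcard]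
      have := Finset.orderEmbOfFin_unique hcard
        (fun i => Finset.mem_image_of_mem (fun i => (t i : W)) (Finset.mem_univ i)) ht'
      rw [← this]

/-- The Ehrenfeucht–Mostowski–Morley method: a class of structures of cardinalities unbounded in
`ℶ_((2 ^ κ)⁺)` has a template. -/
theorem exists_finitelyRealized (hκ : ℵ₀ ≤ κ) (hL' : L'.card ≤ κ)
    (h : ∀ α < (Order.succ ((2 : Cardinal.{u}) ^ κ)).ord,
      ∃ (N : Type u) (_ : L'.Structure N), P N ∧ ℶ_ α ≤ #N) :
    ∃ Φ : Template L', Φ.FinitelyRealized P := by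
  classical
  let θ := (Order.succ ((2 : Cardinal.{u}) ^ κ)).ord
  have h0 : LargelyRealized θ P 0 fun _ => ∅ := fun α hα => by
    obtain ⟨N, inst, hN, hcard⟩ := h α hα
    exact ⟨N, inst, N, linearOrderOfSTO WellOrderingRel, id, hN, Function.injective_id, hcard,
      fun m hm => absurd hm (Nat.not_lt_zero m)⟩
  choose next hnext hlarge using fun n (p : {p : Template L' // LargelyRealized θ P n p}) =>
    p.2.exists_succ hκ hL'
  let p : ∀ n, {p : Template L' // LargelyRealized θ P n p} := fun n =>
    Nat.rec ⟨_, h0⟩ (fun n p => ⟨next n p, hlarge n p⟩) n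
  have hp : ∀ m n, m < n → (p n).1 m = (p (m + 1)).1 m := fun m n hmn => by
    induction n, hmn using Nat.le_induction with
    | base => rfl
    | succ n hn ih => rw [← ih]; exact hnext n (p n) m hn
  -- Stage n settles the types of m-tuples for m < n, so m + 1 is the first stage that settles `m`,
  -- and later stages agree with it.
  refine ⟨fun m => (p (m + 1)).1 m, fun n => ?_⟩
  have hθ : 0 < θ := by
    rw [pos_iff_ne_zero, Ne, ord_eq_zero]
    exact ((zero_le).trans_lt (Order.lt_succ _)).ne'
  -- Finite realization needs only an infinite sequence, and ℶ_0 = ℵ₀.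
  obtain ⟨N, inst, W, _, b, hN, hb, hW, ht⟩ := (p (n + 1)).2 0 hθ
  have : Infinite W := infinite_iff.2 ((aleph0_le_beth 0).trans hW)
  obtain ⟨s, hs⟩ := Infinite.exists_subset_card_eq W n
  refine ⟨N, inst, fun i => b (s.orderEmbOfFin hs i), hN, ⟨b (Classical.arbitrary W)⟩,
    hb.comp (s.orderEmbOfFin hs).injective, fun m t hmt => ?_⟩
  have hmn : m < n + 1 := by
    have := Fintype.card_le_of_injective t hmt.injective
    simp only [Fintype.card_fin] at this
    omega
  refine Eq.trans ?_ (hp m (n + 1) hmn)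
  exact ht m hmn _ ((s.orderEmbOfFin hs).strictMono.comp hmt)

end Template

open Template

variable {L : Language.{u, u}}

/-! ### Cardinalities of vocabularies and Ehrenfeucht–Mostowski models -/

section Card

variable {L' : Language.{u, u}} {M : Type u} {κ : Cardinal.{u}}

theorem card_le_of_card_new_symbols_le (φ : L →ᴸ L') (hκ : ℵ₀ ≤ κ) (hL : L.card ≤ κ)
    (h : #((Set.range φ.onSymbols)ᶜ : Set L'.Symbols) ≤ κ) : L'.card ≤ κ := by
  have h1 : #(Set.range φ.onSymbols) ≤ κ := mk_range_le.trans hL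
  have h2 := mk_sum_compl (Set.range φ.onSymbols)
  calc L'.card = #(Set.range φ.onSymbols) + #((Set.range φ.onSymbols)ᶜ : Set L'.Symbols) := h2.symm
    _ ≤ κ := add_le_of_le hκ h1 h

theorem card_withConstants_le (hκ : ℵ₀ ≤ κ) (hL : L.card ≤ κ) (hM : #M = κ) : L[[M]].card ≤ κ := by
  rw [card_withConstants]
  simp only [lift_id]
  exact add_le_of_le hκ hL hM.le

theorem Template.IsEM.card_le {Φ : Template L'} {I A : Type u} [LinearOrder I] [L'.Structure A]
    {a : I → A} (hA : Φ.IsEM I A a) (hκ : ℵ₀ ≤ κ) (hL' : L'.card ≤ κ) : #A ≤ κ + #I := by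
  have h1 : Function.Surjective fun t : L'.Term I => t.realize a := fun x =>
    exists_term_of_mem_closure_range (hA.generates ▸ Substructure.mem_top x)
  refine (mk_le_of_surjective h1).trans (Term.card_le.trans (max_le (hκ.trans le_self_add) ?_))
  rw [mk_sum, lift_id, lift_id, add_comm]
  refine add_le_add ?_ le_rfl
  refine le_trans ?_ hL'
  exact mk_le_of_injective (f := (Sum.inl : _ → L'.Symbols)) Sum.inl_injective

end Card

/-! ### From closed strong expansions to κ-standard templates -/

variable {k : AbstractClass L} (hk : k.IsAEC) {M : Type u} [L.Structure M] [Nonempty M]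
  {κ : Cardinal.{u}}

/-- The set of named elements is closed under all functions, hence strong, and it is the image of
`M`. -/
theorem ClosedStrong.over_mem {L' : Language.{u, u}} {ψ : L[[M]] →ᴸ L'} {A : Type u}
    [L'.Structure A] (hk : k.IsAEC) (hA : ClosedStrong k ψ A) : (k.over M).MemReduct ψ A := by
  obtain ⟨f, hf⟩ := hA.exists_embedding
  refine ⟨hA.mem, f, hf, ?_⟩
  obtain ⟨S, hS, hs⟩ := hA.strong (Set.range fun m : M => ((nameOf ψ m : L'.Constants) : A))
    (Set.range_nonempty _) fun _ F _ => hA.closed_names F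
  let := (ψ.comp (L.lhomWithConstants M)).reduct A
  refine hk.strong_of_range_eq hs f ?_
  rw [Substructure.coe_subtype, Subtype.range_coe]
  refine hS.trans (congrArg Set.range (funext fun m => (hf m).symm))

theorem ClosedStrong.over_strong {L' : Language.{u, u}} {ψ : L[[M]] →ᴸ L'} {A : Type u}
    [L'.Structure A] (hk : k.IsAEC) (hA : ClosedStrong k ψ A) (S : L'.Substructure A)
    (hS : (S : Set A).Nonempty) : (k.over M).StrongReduct ψ (S : Set A) := by
  have h1 : (k.over M).MemReduct ψ S := over_mem hk (hA.of_embedding hk S.subtype)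
  have h2 := over_mem hk hA
  have h3 := hA.strong _ hS (ClosedUnderUnnamed.of_substructure S)
  rw [← Subtype.range_coe (s := (S : Set A))] at h3
  have h4 := hk.strong_reductAlong (h := S.subtype) h3
  let := ψ.reduct A
  exact ⟨ψ.substructureReduct S, ψ.coe_substructureReduct, h1, h2, h4⟩

include hk in
/-- A template which is finitely realized in structures as in `ClosedStrong` is `κ`-standard. -/
theorem ClosedStrong.isSorOver (hκ : ℵ₀ ≤ κ) (hM : #M = κ) (hL : L.card ≤ κ)
    {Φ : Template (L.withEnum M)}
    (hΦ : Φ.FinitelyRealized fun N _ => ClosedStrong k (L.lhomWithEnum M) N) :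
    Φ.IsSorOver k M κ (L.lhomWithEnum M) := by
  have hcs : ∀ {I : Type u} [LinearOrder I] {A : Type u} [(L.withEnum M).Structure A] {a : I → A},
      Φ.IsEM I A a → ClosedStrong k (L.lhomWithEnum M) A := fun hA =>
    of_isEM hk lhomWithEnum_injective hΦ hA
  have hL' : (L.withEnum M).card ≤ κ := card_withEnum_le hM hκ hL
  have hinj : ∀ (A : Type u) [(L.withEnum M).Structure A],
      ClosedStrong k (L.lhomWithEnum M) A → Function.Injective fun m : M =>
        ((nameOf (L.lhomWithEnum M) m : (L.withEnum M).Constants) : A) := fun A _ hA => by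
    obtain ⟨f, hf⟩ := hA.exists_embedding
    let := ((L.lhomWithEnum M).comp (L.lhomWithConstants M)).reduct A
    intro m m' h
    apply f.injective
    rw [hf, hf]
    exact h
  -- The names alone give κ symbols; equality is needed for the exact cardinality of EM(I, Φ).
  have hL'eq : (L.withEnum M).card = κ := by
    refine hL'.antisymm (hM.symm.trans_le ?_)
    refine mk_le_of_injective (f := fun m => (Sum.inl ⟨0, nameOf (L.lhomWithEnum M) m⟩ :
      (L.withEnum M).Symbols)) fun m m' h => ?_
    have h1 := eq_of_heq (Sigma.mk.inj_iff.1 (Sum.inl_injective h)).2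
    exact Sum.inr_injective (Sum.inl_injective h1)
  have hcard : ∀ (I : Type u) [LinearOrder I] (A : Type u) [(L.withEnum M).Structure A] (a : I → A),
      Φ.IsEM I A a → #A = (L.withEnum M).card + #I := fun I _ A _ a hA => by
    rw [hL'eq]
    refine (hA.card_le hκ hL').antisymm ?_
    have h1 : κ ≤ #A := hM.symm.trans_le (mk_le_of_injective (hinj A (hcs hA)))
    exact add_le_of_le (hκ.trans h1) h1 (mk_le_of_injective hA.injective)
  have hsymb : ∀ X : Set (L.withEnum M).Symbols, #X ≤ κ := fun X => (mk_set_le X).trans hL'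
  have hconst : ∀ (A : Type u) [(L.withEnum M).Structure A], ClosedStrong k (L.lhomWithEnum M) A →
      constantValues (L.withEnum M) A = Set.range fun m : M =>
        ((nameOf (L.lhomWithEnum M) m : (L.withEnum M).Constants) : A) := fun A _ hA => by
    refine subset_antisymm ?_ ?_
    · rintro _ ⟨c, rfl⟩
      exact hA.closed_names c default fun i => i.elim0
    · rintro _ ⟨m, rfl⟩
      exact ⟨_, rfl⟩
  refine ⟨⟨hΦ.proper, lhomWithEnum_injective, hsymb _, hcard, fun I _ A _ a hA =>
    over_mem hk (hcs hA), fun I _ A _ a hA => over_strong hk (hcs hA)⟩, ⟨⟨hΦ.proper, ?_,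
    (hsymb _).trans le_self_add, hcard, fun I _ A _ a hA => (hcs hA).mem,
    fun I _ A _ a hA S hS => (hcs hA).strong _ hS (ClosedUnderUnnamed.of_substructure S)⟩, ?_⟩,
    ?_, ?_, hsymb _, fun I _ A _ a hA => (hcs hA).strong⟩
  · exact ⟨fun h => Sum.inl_injective (Sum.inl_injective h),
      fun h => Sum.inl_injective (Sum.inl_injective h)⟩
  · intro I _ _ A _ a hA
    rw [hconst A (hcs hA)]
    exact (hcs hA).strong _ (Set.range_nonempty _) fun _ F _ => (hcs hA).closed_names F
  · ext c
    rcases c with (c | c) | c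
    · refine iff_of_false ?_ (fun h => h ⟨c, rfl⟩)
      rintro ⟨m, h⟩
      exact Sum.inr_ne_inl (Sum.inl_injective h)
    · refine iff_of_true ⟨c, rfl⟩ ?_
      rintro ⟨d, h⟩
      exact Sum.inl_ne_inr (Sum.inl_injective h)
    · exact absurd rfl c.2
  · intro I _ _ A _ a hA
    rw [hconst A (hcs hA), Set.eq_univ_iff_forall]
    intro x
    have hx : x ∈ Substructure.closure (L.withEnum M) (Set.range a) :=
      hA.generates ▸ Substructure.mem_top x
    -- With an empty skeleton the model is generated by the empty set, so it lies inside the closed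
    -- set of named elements.
    have hle : Substructure.closure (L.withEnum M) (Set.range a) ≤
        { carrier := Set.range fun m : M =>
            ((nameOf (L.lhomWithEnum M) m : (L.withEnum M).Constants) : A)
          fun_mem := (hcs hA).closed_names } := by
      rw [Substructure.closure_le, Set.range_eq_empty]
      exact Set.empty_subset _
    exact hle hx

end FirstOrder.Language

/-! ### The equivalence of the five conditions -/

theorem mainTheorem8 {L : FirstOrder.Language.{u, u}} (k : FirstOrder.Language.AbstractClass L) (hk : k.IsAEC)
    (M : Type u) [L.Structure M] (hM : k.Mem M)
    (κ : Cardinal.{u}) (hMκ : #M = κ) (hκ : k.lst + L.card ≤ κ) :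
    List.TFAE [
      -- (a) `Υᵒʳ_κ[𝔨_M]` is nonempty
      ∃ (L' : FirstOrder.Language.{u, u}) (ψ : L[[M]] →ᴸ L') (Φ : FirstOrder.Language.Template L'),
        Φ.IsOr (k.over M) κ ψ,
      -- (b) `M` has extensions in every cardinality `≥ κ`
      ∀ μ : Cardinal.{u}, κ ≤ μ → ∃ (N : Type u) (_ : L.Structure N),
        k.Mem N ∧ #N = μ ∧ ∃ f : M ↪[L] N, k.Strong f,
      -- (c) `M` has extensions of cardinality `≥ ℶ_α` for all `α < (2 ^ κ)⁺`
      ∀ α : Ordinal.{u}, α < (Order.succ ((2 : Cardinal.{u}) ^ κ)).ord →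
        ∃ (N : Type u) (_ : L.Structure N),
          k.Mem N ∧ ℶ_ α ≤ #N ∧ ∃ f : M ↪[L] N, k.Strong f,
      -- (d) some `Φ` in `Υᵒʳ_κ[𝔨_M]` is such that in all `EM(I, Φ)` every individual constant
      -- takes a value in the copy `{c_a : a ∈ M}` of `M`
      ∃ (L' : FirstOrder.Language.{u, u}) (ψ : L[[M]] →ᴸ L') (Φ : FirstOrder.Language.Template L'),
        Φ.IsOr (k.over M) κ ψ ∧
          ∀ (I : Type u) [LinearOrder I] (A : Type u) [L'.Structure A] (a : I → A),
            Φ.IsEM I A a → FirstOrder.Language.Template.constantValues L' A =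
              Set.range fun m : M => ((FirstOrder.Language.Template.nameOf ψ m : L'.Constants) : A),
      -- (e) `Υˢᵒʳ_κ[𝔨_M]` is nonempty
      ∃ (L' : FirstOrder.Language.{u, u}) (ψ : L[[M]] →ᴸ L') (Φ : FirstOrder.Language.Template L'),
        Φ.IsSorOver k M κ ψ] := by

  classical
  have hlst : k.IsLSTBound k.lst := csInf_mem hk.exists_isLSTBound
  have hlstκ : k.lst ≤ κ := le_self_add.trans hκ
  have hκ₀ : ℵ₀ ≤ κ := hlst.1.trans hlstκ
  have hL : L.card ≤ κ := le_add_self.trans hκ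
  have hne : Nonempty M := by
    rw [← mk_ne_zero_iff, hMκ]
    exact (aleph0_pos.trans_le hκ₀).ne'
  tfae_have 1 → 2 := by
    rintro ⟨L', ψ, Φ, h⟩ μ hμ
    obtain ⟨I, rfl⟩ : ∃ I : Type u, #I = μ := ⟨μ.out, mk_out μ⟩
    let : LinearOrder I := linearOrderOfSTO WellOrderingRel
    obtain ⟨A, _, a, hA⟩ := h.proper I
    obtain ⟨h1, f, -, hf⟩ := h.mem_em I A a hA
    have hL' : L'.card ≤ κ :=
      FirstOrder.Language.card_le_of_card_new_symbols_le ψ hκ₀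
        (FirstOrder.Language.card_withConstants_le hκ₀ hL hMκ) h.card_new_symbols
    refine ⟨A, _, h1, ?_, f, hf⟩
    rw [h.card_em I A a hA]
    exact add_eq_right (hκ₀.trans hμ) (hL'.trans hμ)
  tfae_have 2 → 3 := by
    intro h α _
    obtain ⟨N, inst, hN, hcard, hf⟩ := h (max κ (ℶ_ α)) (le_max_left _ _)
    exact ⟨N, inst, hN, hcard ▸ le_max_right _ _, hf⟩
  tfae_have 3 → 5 := by
    intro h
    obtain ⟨Φ, hΦ⟩ := FirstOrder.Language.Template.exists_finitelyRealized (L' := L.withEnum M)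
      (P := fun N _ => FirstOrder.Language.ClosedStrong k (L.lhomWithEnum M) N) hκ₀
      (FirstOrder.Language.card_withEnum_le hMκ hκ₀ hL)
      fun α hα => by
        obtain ⟨N, _, -, hcard, f, hf⟩ := h α hα
        obtain ⟨inst, hinst⟩ := hk.exists_closedStrong hlstκ hMκ f hf
        exact ⟨N, inst, hinst, hcard⟩
    exact ⟨_, _, Φ, FirstOrder.Language.ClosedStrong.isSorOver hk hκ₀ hMκ hL hΦ⟩
  tfae_have 5 → 4 := by
    rintro ⟨L', ψ, Φ, h⟩
    refine ⟨L', ψ, Φ, h.isOr, fun I _ A _ a hA => subset_antisymm ?_ ?_⟩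
    · rintro _ ⟨c, rfl⟩
      by_cases hc : c ∈ Set.range (FirstOrder.Language.Template.nameOf ψ)
      · obtain ⟨m, rfl⟩ := hc
        exact ⟨m, rfl⟩
      · rw [h.constants_eq, Set.mem_compl_iff, not_not] at hc
        obtain ⟨c, rfl⟩ := hc
        obtain ⟨-, f, hf, -⟩ := h.isOr.mem_em I A a hA
        let := (ψ.comp (L.lhomWithConstants M)).reduct A
        -- A constant of `L` is already interpreted in `M`, and the embedding of `M` preserves its
        -- value.
        exact ⟨(c : M), (hf _).symm.trans (f.map_constants c)⟩
    · rintro _ ⟨m, rfl⟩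
      exact ⟨_, rfl⟩
  tfae_have 4 → 1 := fun ⟨L', ψ, Φ, h, _⟩ => ⟨L', ψ, Φ, h⟩
  tfae_finish
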